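/- Let $\mathcal X,\mathcal Y,\mathcal Z$ be finite alphabets, $P_{YZ|X}$ a discrete memoryless wiretap channel with marginals $P_{Y|X}$ (legitimate receiver) and $P_{Z|X}$ (wiretapper), $Q_Z$ a distribution on $\mathcal Z$, and $s\in(-1,1]$. Logarithms are natural. For distributions $P,Q$ on a finite set let $D(P\|Q)$ be the relative entropy, $D_{1+s}(P\|Q)=\frac1s\log\sum_a P(a)^{1+s}Q(a)^{-s}\in[0,\infty]$ the Rényi divergence for $s\neq0$, and $D_1=D$. For rates $R_0,R_1\ge 0$, a code with deterministic encoder of blocklength $n$ consists of a function $f:\mathcal M_0\times\mathcal M_1\to\mathcal X^n$, where $\mathcal M_i=\{1,\dots,\lfloor e^{nR_i}\rfloor\}$, and a (possibly stochastic) decoder $P_{\widehat M_0\widehat M_1|Y^n}$. The messages $M_0,M_1$ are independent and uniform, and $f(M_0,M_1)$ is sent through the memoryless channel $P_{YZ|X}^n$, with outputs $Y^n,Z^n$. The pair $(R_0,R_1)$ is achievable if some sequence of such codes satisfies $$\mathbb P\big((M_0,M_1)\ne(\widehat M_0,\widehat M_1)\big)\to0\quad\text{and}\quad D_{1+s}\big(P_{M_1Z^n}\big\|P_{M_1}Q_Z^n\big)\to0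 ,$$ and $\mathcal R^{\mathrm{det}}_{1+s}(Q_Z)\subseteq[0,\infty)^2$ is the closure of the set of achievable pairs. Let $\mathcal P(P_{Z|X},Q_Z)$ be the set of input distributions $P_X$ with $\sum_x P_X(x)P_{Z|X}(\cdot|x)=Q_Z$, let $I(X;Y)$ be the mutual information under $P_XP_{Y|X}$, and put $$\widetilde R_{1+s}(P_X,P_{Z|X},Q_Z)=\begin{cases}\sum_xP_X(x)\,D_{1+s}\big(P_{Z|X}(\cdot|x)\big\|Q_Z\big), & s\in(0,1],\\ \sum_xP_X(x)\,D\big(P_{Z|X}(\cdot|x)\big\|Q_Z\big), & s\in(-1,0],\end{cases}$$ $$\mathcal S=\bigcup_{P_X\in\mathcal P(P_{Z|X},Q_Z)}\Big\{(R_0,R_1)\in[0,\infty)^2:\ R_0+R_1\le I(X;Y),\ R_0\ge\widetilde R_{1+s}(P_X,P_{Z|X},Q_Z)\Big\}.$$ Theorem. $\mathcal R^{\mathrm{det}}_{1+s}(Q_Z)=\mathcal S$, except possibly in the degenerate case where the maximum over $P_X\in\mathcal P(P_{Z|X},Q_Z)$ of $I(X;Y)-\widetilde R_{1+s}(P_X,P_{Z|X},Q_Z)$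 exists and is exactly $0$; that is, equality holds whenever $I(X;Y)>\widetilde R_{1+s}$ for some such $P_X$, or $I(X;Y)<\widetilde R_{1+s}$ for all such $P_X$. In every case $\mathcal R^{\mathrm{det}}_{1+s}(Q_Z)\subseteq\mathcal S$, and the two regions contain the same pairs $(R_0,R_1)$ with $R_1>0$. -/

import Mathlib

open scoped NNReal ENNReal Topology
open Filter

namespace Wiretap

noncomputable section

/-! ### Distributions and channels on finite alphabets -/

/-- The joint law `P_X P_{Y|X}` of an input `P` and the output of a channel `K`. -/
def jointLaw {α β : Type*} (P : PMF α) (K : α → PMF β) : PMF (α × β) :=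
  P.bind fun a => (K a).map fun b => (a, b)

/-- The product distribution `P × Q`. -/
def prodLaw {α β : Type*} (P : PMF α) (Q : PMF β) : PMF (α × β) :=
  jointLaw P fun _ => Q

/-- The law of a sequence of independent letters, the `i`-th one distributed as `μ i`. -/
def indepLaw {α : Type*} [Fintype α] {n : ℕ} (μ : Fin n → PMF α) : PMF (Fin n → α) :=
  PMF.ofFintype (fun a => ∏ i, μ i (a i)) <| by
    classical
    rw [← Fintype.piFinset_univ, ← Finset.prod_univ_sum (fun _ => Finset.univ) fun i b => μ i b]
    refine Finset.prod_eq_one fun i _ => ?_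
    rw [← tsum_fintype (L := .unconditional α)]
    exact (μ i).tsum_coe

/-- The `n`-fold product distribution `Q^n`. -/
def iidLaw {α : Type*} [Fintype α] (Q : PMF α) (n : ℕ) : PMF (Fin n → α) :=
  indepLaw fun _ => Q

/-- The memoryless extension of a channel: the law of the output sequence given the input `x`. -/
def memoryless {α β : Type*} [Fintype β] (K : α → PMF β) {n : ℕ} (x : Fin n → α) :
    PMF (Fin n → β) :=
  indepLaw fun i => K (x i)

/-- The marginal channel `P_{Y|X}` to the legitimate receiver. -/
def legitChannel {X Y Z : Type*} (W : X → PMF (Y × Z)) (x : X) : PMF Y := (W x).map Prod.fst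

/-- The marginal channel `P_{Z|X}` to the wiretapper. -/
def tapChannel {X Y Z : Type*} (W : X → PMF (Y × Z)) (x : X) : PMF Z := (W x).map Prod.snd

/-- The set `𝒫(P_{Z|X}, Q_Z)` of input distributions whose output distribution is `Q_Z`. -/
def inducing {X Z : Type*} (K : X → PMF Z) (Q : PMF Z) : Set (PMF X) :=
  {P | P.bind K = Q}

/-! ### Information measures (natural logarithms, values in the extended reals) -/

/-- The relative entropy `D(P ‖ Q)`, which is `⊤` unless `P ≪ Q`. -/
def relEntropy {α : Type*} [Fintype α] (P Q : PMF α) : EReal :=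
  open Classical in
  if ∀ a, Q a = 0 → P a = 0 then
    ((∑ a, (P a).toReal * Real.log ((P a).toReal / (Q a).toReal) : ℝ) : EReal)
  else ⊤

/-- The Rényi divergence `D_{1+s}(P ‖ Q) = (1/s) log ∑ P^{1+s} Q^{-s}` of order `1 + s > 0`, with
the relative entropy at `s = 0`. The sum is taken in `[0, ∞]`, so that (for `s > 0`) a letter with
`P a > 0 = Q a` contributes `∞`, and a letter with `P a = 0` contributes nothing. -/
def renyiDiv {α : Type*} [Fintype α] (s : ℝ) (P Q : PMF α) : EReal :=
  if s = 0 then relEntropy P Q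
  else ((1 / s : ℝ) : EReal) * ENNReal.log (∑ a, P a ^ (1 + s) * Q a ^ (-s))

/-- The mutual information `I(X;Y)` of `(X, Y) ∼ P_X P_{Y|X}`. -/
def mutualInfo {X Y : Type*} [Fintype X] [Fintype Y] (P : PMF X) (K : X → PMF Y) : EReal :=
  relEntropy (jointLaw P K) (prodLaw P (P.bind K))

/-- The quantity `R̃_{1+s}(P_X, P_{Z|X}, Q_Z)`: the average over `P_X` of the divergences
`D_{1+s}(P_{Z|X=x} ‖ Q_Z)` if `s > 0`, and the conditional relative entropy
`D(P_{Z|X} ‖ Q_Z | P_X)` if `-1 < s ≤ 0`. -/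
def resolvabilityRate {X Z : Type*} [Fintype X] [Fintype Z] (s : ℝ)
    (P : PMF X) (K : X → PMF Z) (Q : PMF Z) : EReal :=
  if 0 < s then ∑ x, ((P x : ℝ≥0∞) : EReal) * renyiDiv s (K x) Q
  else ∑ x, ((P x : ℝ≥0∞) : EReal) * relEntropy (K x) Q

/-! ### Codes with a deterministic encoder -/

/-- The number of messages of a code of blocklength `n` and rate `R`. -/
def numMessages (n : ℕ) (R : ℝ≥0) : ℕ := ⌊Real.exp (n * R)⌋₊

instance (n : ℕ) (R : ℝ≥0) : NeZero (numMessages n R) :=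
  ⟨(Nat.floor_pos.2 (Real.one_le_exp (by positivity))).ne'⟩

/-- A code of blocklength `n` with `k₀` non-secret and `k₁` secret messages, a deterministic
encoder and a (possibly stochastic) decoder. -/
structure DetCode (X Y : Type*) (n k₀ k₁ : ℕ) where
  encode : Fin k₀ × Fin k₁ → Fin n → X
  decode : (Fin n → Y) → PMF (Fin k₀ × Fin k₁)

namespace DetCode

variable {X Y Z : Type*} [Fintype Y] [Fintype Z] {n k₀ k₁ : ℕ} [NeZero k₀] [NeZero k₁]

/-- The law of `((M₀, M₁), (Y^n, Z^n), (M̂₀, M̂₁))` induced by the code: uniform messages are encoded,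
sent through the memoryless channel `W`, and the output `Y^n` is decoded. -/
def inducedLaw (C : DetCode X Y n k₀ k₁) (W : X → PMF (Y × Z)) :
    PMF ((Fin k₀ × Fin k₁) × (Fin n → Y × Z) × (Fin k₀ × Fin k₁)) :=
  (PMF.uniformOfFintype (Fin k₀ × Fin k₁)).bind fun m =>
    (memoryless W (C.encode m)).bind fun yz =>
      (C.decode fun i => (yz i).1).map fun m' => (m, yz, m')

/-- The probability that `(M₀, M₁) ≠ (M̂₀, M̂₁)`. -/
def errorProb (C : DetCode X Y n k₀ k₁) (W : X → PMF (Y × Z)) : ℝ≥0∞ :=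
  (C.inducedLaw W).toOuterMeasure {ω | ω.1 ≠ ω.2.2}

/-- The joint law `P_{M₁ Z^n}` of the secret message and the wiretapper's observation. -/
def secretTapLaw (C : DetCode X Y n k₀ k₁) (W : X → PMF (Y × Z)) :
    PMF (Fin k₁ × (Fin n → Z)) :=
  (C.inducedLaw W).map fun ω => (ω.1.2, fun i => (ω.2.1 i).2)

/-- The leakage `D_{1+s}(P_{M₁ Z^n} ‖ P_{M₁} Q_Z^n)`. -/
def leakage (C : DetCode X Y n k₀ k₁) (W : X → PMF (Y × Z)) (Q : PMF Z) (s : ℝ) : EReal :=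
  renyiDiv s (C.secretTapLaw W) (prodLaw ((C.secretTapLaw W).map Prod.fst) (iidLaw Q n))

end DetCode

/-! ### The two regions -/

section Regions

variable {X Y Z : Type*} [Fintype Y] [Fintype Z]

/-- `(R₀, R₁)` is achievable: some sequence of codes of these rates has vanishing error probability
and vanishing leakage. -/
def IsAchievable (W : X → PMF (Y × Z)) (Q : PMF Z) (s : ℝ) (R : ℝ≥0 × ℝ≥0) : Prop :=
  ∃ C : ∀ n : ℕ, DetCode X Y n (numMessages n R.1) (numMessages n R.2),
    Tendsto (fun n => (C n).errorProb W) atTop (𝓝 0) ∧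
    Tendsto (fun n => (C n).leakage W Q s) atTop (𝓝 0)

/-- The `(Q_Z, 1+s)`-admissible region for deterministic encoders. -/
def admissibleRegion (W : X → PMF (Y × Z)) (Q : PMF Z) (s : ℝ) : Set (ℝ≥0 × ℝ≥0) :=
  closure {R | IsAchievable W Q s R}

/-- The single-letter region: the union over all `P_X` that induce `Q_Z` of the sets given by
`R₀ + R₁ ≤ I(X;Y)` and `R₀ ≥ R̃_{1+s}(P_X, P_{Z|X}, Q_Z)`. -/
def singleLetterRegion [Fintype X] (W : X → PMF (Y × Z)) (Q : PMF Z) (s : ℝ) :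
    Set (ℝ≥0 × ℝ≥0) :=
  ⋃ P ∈ inducing (tapChannel W) Q,
    {R | (((R.1 : ℝ) + (R.2 : ℝ) : ℝ) : EReal) ≤ mutualInfo P (legitChannel W) ∧
      resolvabilityRate s P (tapChannel W) Q ≤ ((R.1 : ℝ) : EReal)}

end Regions

end

end Wiretap

set_option linter.unusedSectionVars false

namespace Wiretap

/-! ### Sums over product spaces -/

section ProductSums

variable {ι α : Type*} [Fintype ι] [DecidableEq ι] [Fintype α]

/-! The converse evaluates every single-letter quantity at one input distribution, the empirical
letter frequency `letterFreq` of the whole codebook. Vanishing leakage of any order above zero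
forces a vanishing squared Hellinger distance (`hellinger_le_of_renyiDiv_le`), so the output of
`letterFreq` approaches `Q`. Fano's inequality (`one_sub_error_mul_log_le`) bounds `R₀ + R₁` by its
mutual information.

The lower bound on `R₀` is where the deterministic encoder matters: given `M₁`, the wiretapper sees
a mixture of only `k₀` codeword laws. For `s > 0`, superadditivity of `x ^ (1 + s)` bounds the
code's power sum below by `k₀ ^ (-s)` times the average codeword power sum, and Jensen turns this
into a bound on the average letter divergence. For `s ≤ 0`, each codeword law is at most `4 k₀ Q^n`
outside an event whose mass the Hellinger distance controls, so the relative entropy replaces the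
Rényi divergence. Compactness of the simplex gives the limit (`mem_singleLetterRegion_of_tendsto`),
which also shows that the region is closed.

For achievability, codewords are drawn from the product distribution conditioned on a small sum of
letter divergences. The conditioning makes the average of the divergences decisive, rather than the
larger logarithm of an average of power sums, and costs only a factor tending to one. The power sum
of a mixture splits into single codewords and pairs (`sum_rpow_mul_le`): the former vanish when `R₀`
exceeds the rate, while pair correlations average to about one. A likelihood-ratio test decodes, and
one averaging argument selects a codebook good for both purposes (`exists_code`). Orders `s ≤ 0` are
handled by a small positive order, whose power sum controls them all.

Pairs with `R₁ > 0` are limits of strictly interior ones, obtained by shifting a little secret rate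
into `R₀`. If some input has `I > R̃`, the region contains a point with `R₁ > 0`, and mixing with it
(the region is convex) reaches the pairs with `R₁ = 0`. If `I < R̃` always, the region is empty. In
the degenerate case neither argument is available. -/

lemma sum_pi_prod (w : ι → α → ℝ) : ∑ a : ι → α, ∏ i, w i (a i) = ∏ i, ∑ b, w i b := by
  classical
  rw [← Fintype.piFinset_univ, ← Finset.prod_univ_sum (fun _ => Finset.univ) fun i b => w i b]

lemma sum_pi_prod_mul {w : ι → α → ℝ} (hw : ∀ i, ∑ b, w i b = 1) (i : ι) (f : α → ℝ) :
    ∑ a : ι → α, (∏ j, w j (a j)) * f (a i) = ∑ b, w i b * f b := by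
  have h := sum_pi_prod fun j b => w j b * if j = i then f b else 1
  rw [Finset.prod_eq_single i] at h
  · simpa only [Finset.prod_mul_distrib, Finset.prod_ite_eq', Finset.mem_univ, if_true] using h
  · intro j _ hj
    simp [hj, hw]
  · simp

lemma sum_pi_prod_mul_mul {w : ι → α → ℝ} (hw : ∀ i, ∑ b, w i b = 1) {i j : ι} (hij : i ≠ j)
    (f g : α → ℝ) :
    ∑ a : ι → α, (∏ k, w k (a k)) * (f (a i) * g (a j)) =
      (∑ b, w i b * f b) * ∑ b, w j b * g b := by
  have h := sum_pi_prod fun k b => w k b * ((if k = i then f b else 1) * if k = j then g b else 1)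
  rw [Finset.prod_eq_mul i j hij] at h
  · simpa only [Finset.prod_mul_distrib, Finset.prod_ite_eq', Finset.mem_univ, if_true, hij,
      hij.symm, if_false, one_mul, mul_one] using h
  · rintro k _ ⟨hi, hj⟩
    simp [hi, hj, hw]
  · simp
  · simp

lemma sum_pi_prod_mul_pair {w : ι → α → ℝ} (hw : ∀ i, ∑ b, w i b = 1) {i j : ι} (hij : i ≠ j)
    (f : α → α → ℝ) :
    ∑ a : ι → α, (∏ k, w k (a k)) * f (a i) (a j) = ∑ b, ∑ c, w i b * w j c * f b c := by
  classical
  -- Expanding over the value `c` of the second coordinate turns `f` into a sum of products of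
  -- one-coordinate functions.
  have h1 : ∀ a : ι → α, (∏ k, w k (a k)) * f (a i) (a j) =
      ∑ c, (∏ k, w k (a k)) * (f (a i) c * if a j = c then 1 else 0) := by
    intro a
    simp
  simp_rw [h1]
  rw [Finset.sum_comm]
  simp_rw [fun c => sum_pi_prod_mul_mul hw hij (fun b => f b c) fun b => if b = c then (1 : ℝ) else 0]
  rw [Finset.sum_comm]
  refine Finset.sum_congr rfl fun c _ => ?_
  simp [Finset.sum_mul]
  refine Finset.sum_congr rfl fun b _ => by ring

lemma sum_pi_prod_mul_sum {w : ι → α → ℝ} (hw : ∀ i, ∑ b, w i b = 1) (f : ι → α → ℝ) :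
    ∑ a : ι → α, (∏ j, w j (a j)) * ∑ i, f i (a i) = ∑ i, ∑ b, w i b * f i b := by
  simp_rw [Finset.mul_sum]
  rw [Finset.sum_comm]
  exact Finset.sum_congr rfl fun i _ => sum_pi_prod_mul hw i (f i)

lemma exists_pi_prod_pos {w : ι → α → ℝ} (hw : ∀ i, ∑ b, w i b = 1)
    (i : ι) {b : α} (hb : 0 < w i b) : ∃ a : ι → α, a i = b ∧ 0 < ∏ j, w j (a j) := by
  have h : ∀ j, ∃ c, 0 < w j c := fun j => by
    by_contra! hc
    have : ∑ c, w j c ≤ 0 := Finset.sum_nonpos fun c _ => hc c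
    linarith [hw j]
  choose c hc using h
  refine ⟨Function.update c i b, by simp, Finset.prod_pos fun j _ => ?_⟩
  by_cases hj : j = i
  · subst hj; simpa using hb
  · simpa [hj] using hc j

end ProductSums

/-! ### Real-valued probabilities -/

section RealProbabilities

variable {α β : Type*}

/-- The probability of a letter as a real number. -/
def pr (P : PMF α) (a : α) : ℝ := (P a).toReal

lemma pr_nonneg (P : PMF α) (a : α) : 0 ≤ pr P a := ENNReal.toReal_nonneg

lemma pr_eq_zero {P : PMF α} {a : α} : pr P a = 0 ↔ P a = 0 := by
  simp [pr, ENNReal.toReal_eq_zero_iff, P.apply_ne_top]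

lemma ofReal_pr (P : PMF α) (a : α) : ENNReal.ofReal (pr P a) = P a :=
  ENNReal.ofReal_toReal (P.apply_ne_top a)

lemma ext_pr {P Q : PMF α} (h : ∀ a, pr P a = pr Q a) : P = Q := by
  ext a
  rw [← ofReal_pr, ← ofReal_pr, h]

lemma sum_pr [Fintype α] (P : PMF α) : ∑ a, pr P a = 1 := by
  unfold pr
  rw [← ENNReal.toReal_sum fun a _ => P.apply_ne_top a, ← tsum_fintype (L := .unconditional α),
    P.tsum_coe, ENNReal.toReal_one]

lemma pr_le_one (P : PMF α) (a : α) : pr P a ≤ 1 :=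
  ENNReal.toReal_le_of_le_ofReal zero_le_one (by simpa using P.coe_le_one a)

lemma pr_bind [Fintype α] (P : PMF α) (K : α → PMF β) (b : β) :
    pr (P.bind K) b = ∑ a, pr P a * pr (K a) b := by
  unfold pr
  rw [PMF.bind_apply, tsum_fintype, ENNReal.toReal_sum]
  · simp
  · exact fun a _ => ENNReal.mul_ne_top (P.apply_ne_top a) ((K a).apply_ne_top b)

lemma pr_map [Fintype α] [DecidableEq β] (P : PMF α) (f : α → β) (b : β) :
    pr (P.map f) b = ∑ a, if b = f a then pr P a else 0 := by
  classical
  unfold pr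
  rw [PMF.map_apply, tsum_fintype, ENNReal.toReal_sum]
  · refine Finset.sum_congr rfl fun a _ => ?_
    split_ifs <;> simp_all
  · intro a _
    split_ifs
    · exact P.apply_ne_top a
    · simp

lemma pr_jointLaw [Fintype α] [Fintype β] (P : PMF α) (K : α → PMF β) (a : α) (b : β) :
    pr (jointLaw P K) (a, b) = pr P a * pr (K a) b := by
  classical
  unfold jointLaw
  rw [pr_bind, Finset.sum_eq_single a]
  · rw [pr_map]; simp
  · intro c _ hc
    rw [pr_map]; simp [hc.symm]
  · simp

lemma pr_prodLaw [Fintype α] [Fintype β] (P : PMF α) (Q : PMF β) (a : α) (b : β) :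
    pr (prodLaw P Q) (a, b) = pr P a * pr Q b := pr_jointLaw P _ a b

lemma pr_indepLaw [Fintype α] {n : ℕ} (μ : Fin n → PMF α) (a : Fin n → α) :
    pr (indepLaw μ) a = ∏ i, pr (μ i) (a i) := by
  simp [pr, indepLaw]

lemma pr_memoryless [Fintype β] (K : α → PMF β) {n : ℕ} (x : Fin n → α) (y : Fin n → β) :
    pr (memoryless K x) y = ∏ i, pr (K (x i)) (y i) := pr_indepLaw _ _

lemma pr_iidLaw [Fintype α] (Q : PMF α) {n : ℕ} (a : Fin n → α) :
    pr (iidLaw Q n) a = ∏ i, pr Q (a i) := pr_indepLaw _ _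

lemma indepLaw_map [Fintype α] [Fintype β] {n : ℕ} (μ : Fin n → PMF α) (f : α → β) :
    (indepLaw μ).map (fun a i => f (a i)) = indepLaw fun i => (μ i).map f := by
  classical
  refine ext_pr fun b => ?_
  rw [pr_map, pr_indepLaw]
  simp_rw [pr_map, pr_indepLaw]
  rw [← sum_pi_prod fun i a => if b i = f a then pr (μ i) a else 0]
  refine Finset.sum_congr rfl fun a _ => ?_
  split_ifs with h
  · exact Finset.prod_congr rfl fun i _ => by rw [if_pos (congrFun h i)]
  · obtain ⟨i, hi⟩ : ∃ i, b i ≠ f (a i) := by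
      by_contra! hc
      exact h (funext hc)
    exact (Finset.prod_eq_zero (Finset.mem_univ i) (if_neg hi)).symm

lemma pr_uniform [Fintype α] [Nonempty α] (a : α) :
    pr (PMF.uniformOfFintype α) a = (Fintype.card α : ℝ)⁻¹ := by
  simp [pr]

end RealProbabilities

/-! ### The laws induced by a code -/

section InducedLaws

namespace DetCode

variable {X Y Z : Type*} [Fintype Y] [Fintype Z] {n k₀ k₁ : ℕ} [NeZero k₀] [NeZero k₁]
  (C : DetCode X Y n k₀ k₁) (W : X → PMF (Y × Z))

/-- The decoder sees only the `Y` coordinates, so the tap output can be summed out letter by letter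
before decoding. -/
lemma inducedLaw_map_messages :
    (C.inducedLaw W).map (fun ω => (ω.1, ω.2.2)) =
      jointLaw (PMF.uniformOfFintype (Fin k₀ × Fin k₁)) fun m =>
        (memoryless (legitChannel W) (C.encode m)).bind C.decode := by
  have h : ∀ m, memoryless (legitChannel W) (C.encode m) =
      (memoryless W (C.encode m)).map fun a i => (a i).1 := fun m =>
    (indepLaw_map (fun i => W (C.encode m i)) Prod.fst).symm
  simp only [inducedLaw, jointLaw, PMF.map_bind, PMF.map_comp, h, PMF.bind_map]
  rfl

lemma secretTapLaw_eq :
    C.secretTapLaw W = (PMF.uniformOfFintype (Fin k₀ × Fin k₁)).bind fun m =>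
      (memoryless (tapChannel W) (C.encode m)).map fun z => (m.2, z) := by
  have h : ∀ m, memoryless (tapChannel W) (C.encode m) =
      (memoryless W (C.encode m)).map fun a i => (a i).2 := fun m =>
    (indepLaw_map (fun i => W (C.encode m i)) Prod.snd).symm
  simp only [secretTapLaw, inducedLaw, PMF.map_bind, PMF.map_comp, h]
  congr 1
  funext m
  rw [← PMF.bind_pure_comp]
  congr 1
  funext yz
  exact PMF.map_const (C.decode fun i => (yz i).1) (m.2, fun i => (yz i).2)

lemma errorProb_eq :
    C.errorProb W = ENNReal.ofReal (((k₀ : ℝ) * k₁)⁻¹ * ∑ m, ∑ y,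
      (∏ i, pr (legitChannel W (C.encode m i)) (y i)) * (1 - pr (C.decode y) m)) := by
  classical
  have h1 : C.errorProb W = ((C.inducedLaw W).map (fun ω => (ω.1, ω.2.2))).toOuterMeasure
      {p | p.1 ≠ p.2} := by
    rw [PMF.toOuterMeasure_map_apply]; rfl
  rw [h1, inducedLaw_map_messages, PMF.toOuterMeasure_apply_fintype]
  rw [show ∀ f : (Fin k₀ × Fin k₁) × (Fin k₀ × Fin k₁) → ℝ≥0∞,
    Set.indicator {p | p.1 ≠ p.2} f = fun p => if p.1 ≠ p.2 then f p else 0 from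
      fun f => by funext p; simp [Set.indicator_apply]]
  have h2 : ∀ p : (Fin k₀ × Fin k₁) × (Fin k₀ × Fin k₁),
      (if p.1 ≠ p.2 then (jointLaw (PMF.uniformOfFintype (Fin k₀ × Fin k₁)) fun m =>
        (memoryless (legitChannel W) (C.encode m)).bind C.decode) p else 0) =
      ENNReal.ofReal (if p.1 ≠ p.2 then ((k₀ : ℝ) * k₁)⁻¹ * ∑ y,
        (∏ i, pr (legitChannel W (C.encode p.1 i)) (y i)) * pr (C.decode y) p.2 else 0) := by
    rintro ⟨m, m'⟩
    split_ifs
    · rw [← ofReal_pr, pr_jointLaw, pr_uniform, pr_bind]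
      simp [pr_memoryless]
    · simp
  rw [Finset.sum_congr rfl fun p _ => h2 p, ← ENNReal.ofReal_sum_of_nonneg]
  · congr 1
    rw [Fintype.sum_prod_type, Finset.mul_sum]
    refine Finset.sum_congr rfl fun m _ => ?_
    simp_rw [← mul_ite_zero]
    rw [← Finset.mul_sum, ← Finset.sum_filter, Finset.sum_comm]
    congr 1
    refine Finset.sum_congr rfl fun y _ => ?_
    rw [← Finset.mul_sum]
    congr 1
    have := sum_pr (C.decode y)
    rw [← Finset.add_sum_erase _ _ (Finset.mem_univ m)] at this
    rw [← this, add_sub_cancel_left]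
    refine Finset.sum_congr ?_ fun _ _ => rfl
    ext m'
    simp [eq_comm]
  · intro p _
    split_ifs
    · exact mul_nonneg (by positivity) (Finset.sum_nonneg fun y _ =>
        mul_nonneg (Finset.prod_nonneg fun i _ => pr_nonneg _ _) (pr_nonneg _ _))
    · exact le_rfl

lemma pr_secretTapLaw (j : Fin k₁) (z : Fin n → Z) :
    pr (C.secretTapLaw W) (j, z) = ∑ l, ((k₀ : ℝ) * k₁)⁻¹ *
      ∏ i, pr (tapChannel W (C.encode (l, j) i)) (z i) := by
  classical
  rw [secretTapLaw_eq, pr_bind, Fintype.sum_prod_type]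
  refine Finset.sum_congr rfl fun l _ => ?_
  simp only [pr_uniform, pr_map, Prod.mk.injEq, pr_memoryless]
  rw [Finset.sum_eq_single j]
  · simp
  · intro i _ hi
    simp [hi.symm]
  · simp

/-- Each codeword's output law has total mass one, so the marginal of the secret message is uniform
on `Fin k₁`. -/
lemma pr_secretTapLaw_prod (Q : PMF Z) (j : Fin k₁) (z : Fin n → Z) :
    pr (prodLaw ((C.secretTapLaw W).map Prod.fst) (iidLaw Q n)) (j, z) =
      (k₁ : ℝ)⁻¹ * ∏ i, pr Q (z i) := by
  classical
  rw [pr_prodLaw, pr_iidLaw, pr_map]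
  congr 1
  have h0 : (k₀ : ℝ) ≠ 0 := NeZero.ne _
  rw [Fintype.sum_prod_type, Finset.sum_eq_single j]
  · simp only [if_true]
    simp_rw [pr_secretTapLaw]
    rw [Finset.sum_comm]
    have h : ∀ l : Fin k₀, ∑ z : Fin n → Z, ∏ i, pr (tapChannel W (C.encode (l, j) i)) (z i) = 1 :=
      fun l => by
        rw [sum_pi_prod fun i b => pr (tapChannel W (C.encode (l, j) i)) b]
        simp [sum_pr]
    simp_rw [← Finset.mul_sum, h]
    simp
    field_simp
  · intro i _ hi
    simp [hi.symm]
  · simp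

end DetCode

end InducedLaws

/-! ### Rényi divergences in real terms -/

section Renyi

lemma powerSum_term_nonneg {α : Type*} (s : ℝ) (P Q : PMF α) (a : α) :
    0 ≤ pr P a ^ (1 + s) * pr Q a ^ (-s) :=
  mul_nonneg (Real.rpow_nonneg (pr_nonneg _ _) _) (Real.rpow_nonneg (pr_nonneg _ _) _)

variable {α : Type*} [Fintype α]

/-- Absolute continuity `P ≪ Q`. -/
def AbsCont (P Q : PMF α) : Prop := ∀ a, pr Q a = 0 → pr P a = 0

/-- The power sum `∑ P^{1+s} Q^{-s}` with the real conventions at zero. -/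
noncomputable def powerSum (s : ℝ) (P Q : PMF α) : ℝ := ∑ a, pr P a ^ (1 + s) * pr Q a ^ (-s)

/-- The relative entropy as a real number. -/
noncomputable def klReal (P Q : PMF α) : ℝ := ∑ a, pr P a * Real.log (pr P a / pr Q a)

/-- The squared Hellinger distance. -/
noncomputable def hellinger (P Q : PMF α) : ℝ := ∑ a, (√(pr P a) - √(pr Q a)) ^ 2

lemma hellinger_nonneg (P Q : PMF α) : 0 ≤ hellinger P Q :=
  Finset.sum_nonneg fun _ _ => sq_nonneg _

lemma powerSum_nonneg (s : ℝ) (P Q : PMF α) : 0 ≤ powerSum s P Q :=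
  Finset.sum_nonneg fun a _ => powerSum_term_nonneg s P Q a

lemma relEntropy_eq {P Q : PMF α} (h : AbsCont P Q) : relEntropy P Q = (klReal P Q : EReal) := by
  unfold relEntropy
  rw [if_pos fun a ha => pr_eq_zero.1 (h a (pr_eq_zero.2 ha))]
  rfl

lemma absCont_of_relEntropy {P Q : PMF α} (h : relEntropy P Q ≠ ⊤) : AbsCont P Q := by
  unfold relEntropy at h
  split_ifs at h with h'
  · exact fun a ha => pr_eq_zero.2 (h' a (pr_eq_zero.1 ha))
  · exact absurd rfl h

/-- For `s > 0` a zero of `Q` gives `0 ^ (-s) = ∞` in the extended reals but `0` in the reals; `P ≪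
Q` makes such terms vanish on both sides. For `s < 0` the exponent is positive and the conventions
agree. -/
lemma sum_rpow_eq_powerSum {s : ℝ} (hs : -1 < s) {P Q : PMF α} (h : s < 0 ∨ AbsCont P Q) :
    ∑ a, P a ^ (1 + s) * Q a ^ (-s) = ENNReal.ofReal (powerSum s P Q) := by
  unfold powerSum
  rw [ENNReal.ofReal_sum_of_nonneg fun a _ => powerSum_term_nonneg s P Q a]
  refine Finset.sum_congr rfl fun a _ => ?_
  rw [ENNReal.ofReal_mul (Real.rpow_nonneg (pr_nonneg _ _) _),
    ← ENNReal.ofReal_rpow_of_nonneg (pr_nonneg _ _) (by linarith), ofReal_pr]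
  by_cases hP : pr P a = 0
  · rw [pr_eq_zero.1 hP, ENNReal.zero_rpow_of_pos (by linarith)]
    simp
  · congr 1
    rcases h with h | h
    · rw [← ENNReal.ofReal_rpow_of_nonneg (pr_nonneg _ _) (by linarith), ofReal_pr]
    · have : 0 < pr Q a := lt_of_le_of_ne (pr_nonneg _ _) fun h' => hP (h a h'.symm)
      rw [← ENNReal.ofReal_rpow_of_pos this, ofReal_pr]

/-- Jensen's inequality: `D ≤ D_{1+s}` for `s > 0` and `D_{1+s} ≤ D` for `s < 0`. -/
lemma exp_klReal_le_powerSum (s : ℝ) {P Q : PMF α} (h : AbsCont P Q) :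
    Real.exp (s * klReal P Q) ≤ powerSum s P Q := by
  -- The tangent line to `exp` at the mean `s * klReal P Q` lies below `exp`; averaging it under `P`
  -- leaves its value at the mean.
  have key : ∀ a, pr P a * (Real.exp (s * klReal P Q) *
      (1 + (s * Real.log (pr P a / pr Q a) - s * klReal P Q))) ≤
      pr P a ^ (1 + s) * pr Q a ^ (-s) := by
    intro a
    rcases (pr_nonneg P a).eq_or_lt with h0 | h0
    · exact (by rw [← h0, zero_mul] : _ = (0 : ℝ)).trans_le (powerSum_term_nonneg s P Q a)
    have hq : 0 < pr Q a := lt_of_le_of_ne (pr_nonneg _ _) fun h' => h0.ne' (h a h'.symm)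
    have e : pr P a ^ (1 + s) * pr Q a ^ (-s) =
        pr P a * Real.exp (s * Real.log (pr P a / pr Q a)) := by
      rw [Real.rpow_add h0, Real.rpow_one, mul_assoc, Real.rpow_neg hq.le, mul_comm s,
        Real.exp_mul, Real.exp_log (by positivity), Real.div_rpow h0.le hq.le, div_eq_mul_inv]
    rw [e]
    refine mul_le_mul_of_nonneg_left ?_ h0.le
    have := Real.add_one_le_exp (s * Real.log (pr P a / pr Q a) - s * klReal P Q)
    calc _ ≤ Real.exp (s * klReal P Q) *
          Real.exp (s * Real.log (pr P a / pr Q a) - s * klReal P Q) := by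
          gcongr; linarith
      _ = _ := by rw [← Real.exp_add]; congr 1; ring
  refine le_trans (le_of_eq ?_) (Finset.sum_le_sum fun a _ => key a)
  have : ∀ a, pr P a * (Real.exp (s * klReal P Q) *
      (1 + (s * Real.log (pr P a / pr Q a) - s * klReal P Q))) =
      Real.exp (s * klReal P Q) * ((1 - s * klReal P Q) * pr P a +
        s * (pr P a * Real.log (pr P a / pr Q a))) := fun a => by ring
  simp_rw [this]
  rw [← Finset.mul_sum, Finset.sum_add_distrib, ← Finset.mul_sum, ← Finset.mul_sum, sum_pr]
  change _ = Real.exp (s * klReal P Q) * ((1 - s * klReal P Q) * 1 + s * klReal P Q)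
  ring

lemma powerSum_pos (s : ℝ) {P Q : PMF α} (h : AbsCont P Q) : 0 < powerSum s P Q :=
  (Real.exp_pos _).trans_le (exp_klReal_le_powerSum s h)

lemma renyiDiv_eq {s : ℝ} (hs : -1 < s) (hs0 : s ≠ 0) {P Q : PMF α} (h : AbsCont P Q) :
    renyiDiv s P Q = ((1 / s * Real.log (powerSum s P Q) : ℝ) : EReal) := by
  unfold renyiDiv
  rw [if_neg hs0, sum_rpow_eq_powerSum hs (Or.inr h), ENNReal.log_ofReal_of_pos (powerSum_pos s h)]
  norm_cast

lemma absCont_of_renyiDiv {s : ℝ} (hs : 0 ≤ s) {P Q : PMF α} (h : renyiDiv s P Q ≠ ⊤) :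
    AbsCont P Q := by
  rcases hs.eq_or_lt with rfl | hs
  · exact absCont_of_relEntropy (by simpa [renyiDiv] using h)
  · intro a ha
    by_contra hP
    refine h ?_
    have : ∑ a, P a ^ (1 + s) * Q a ^ (-s) = ⊤ := by
      rw [ENNReal.sum_eq_top]
      refine ⟨a, Finset.mem_univ a, ?_⟩
      rw [pr_eq_zero.1 ha, ENNReal.zero_rpow_of_neg (by linarith), ENNReal.mul_top]
      intro h'
      rcases ENNReal.rpow_eq_zero_iff.1 h' with h' | h'
      · exact hP (pr_eq_zero.2 h'.1)
      · exact P.apply_ne_top a h'.1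
    rw [renyiDiv, if_neg hs.ne', this, ENNReal.log_top]
    exact EReal.coe_mul_top_of_pos (by positivity)

/-- Apply `log x ≤ x - 1` at `x = √(q / p)`: this gives `p log (p / q) ≥ 2p - 2√(pq)`, and the total
masses cancel on summation. -/
lemma hellinger_le_klReal {P Q : PMF α} (h : AbsCont P Q) : hellinger P Q ≤ klReal P Q := by
  have key : ∀ a, (√(pr P a) - √(pr Q a)) ^ 2 ≤
      pr P a * Real.log (pr P a / pr Q a) - pr P a + pr Q a := by
    intro a
    have hq' := pr_nonneg Q a
    rcases (pr_nonneg P a).eq_or_lt with h0 | h0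
    · simp [← h0, Real.sq_sqrt hq']
    have hq : 0 < pr Q a := lt_of_le_of_ne (pr_nonneg _ _) fun h' => h0.ne' (h a h'.symm)
    have e : Real.log (pr P a / pr Q a) = -(2 * Real.log (√(pr Q a) / √(pr P a))) := by
      rw [Real.log_div h0.ne' hq.ne', Real.log_div (by positivity) (by positivity),
        Real.log_sqrt h0.le, Real.log_sqrt hq.le]
      ring
    have h1 := Real.log_le_sub_one_of_pos (show 0 < √(pr Q a) / √(pr P a) by positivity)
    have h2 : pr P a * (√(pr Q a) / √(pr P a)) = √(pr P a) * √(pr Q a) := by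
      have := Real.mul_self_sqrt h0.le
      field_simp
      rw [Real.sq_sqrt h0.le]
    rw [e]
    have h3 := mul_le_mul_of_nonneg_left h1 h0.le
    rw [mul_sub, h2] at h3
    nlinarith [Real.sq_sqrt h0.le, Real.sq_sqrt hq']
  have := Finset.sum_le_sum fun a (_ : a ∈ Finset.univ) => key a
  rw [Finset.sum_add_distrib, Finset.sum_sub_distrib, sum_pr, sum_pr] at this
  change hellinger P Q ≤ klReal P Q - 1 + 1 at this
  linarith

/-- Since `p ^ (1 - t) * q ^ t = p ^ (1 - 2t) * (√p √q) ^ (2t)`, the weighted AM-GM inequality can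
be applied to `p` and `√p √q`; the gap to the arithmetic mean of `p` and `q` is then exactly `t (√p
- √q) ^ 2`. -/
lemma geom_mean_add_sq_sub_sqrt_le_of_le_half {p q t : ℝ} (hp : 0 ≤ p) (hq : 0 ≤ q) (ht : 0 ≤ t)
    (ht' : t ≤ 1 / 2) :
    p ^ (1 - t) * q ^ t + t * (√p - √q) ^ 2 ≤ (1 - t) * p + t * q := by
  have h := Real.geom_mean_le_arith_mean2_weighted (w₁ := 1 - 2 * t) (w₂ := 2 * t)
    (p₁ := p) (p₂ := √p * √q) (by linarith) (by linarith) hp (by positivity) (by ring)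
  have e : p ^ (1 - t) * q ^ t = p ^ (1 - 2 * t) * (√p * √q) ^ (2 * t) := by
    rw [Real.mul_rpow (by positivity) (by positivity), Real.rpow_mul (by positivity),
      Real.rpow_mul (by positivity), Real.rpow_two, Real.rpow_two, Real.sq_sqrt hp,
      Real.sq_sqrt hq, ← mul_assoc, ← Real.rpow_add_of_nonneg hp (by linarith) ht]
    congr 2
    ring
  rw [e]
  nlinarith [Real.sq_sqrt hp, Real.sq_sqrt hq]

lemma geom_mean_add_sq_sub_sqrt_le {p q t : ℝ} (hp : 0 ≤ p) (hq : 0 ≤ q) (ht : 0 ≤ t)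
    (ht' : t ≤ 1) :
    p ^ (1 - t) * q ^ t + min t (1 - t) * (√p - √q) ^ 2 ≤ (1 - t) * p + t * q := by
  rcases le_total t (1 / 2) with h | h
  · rw [min_eq_left (by linarith)]
    exact geom_mean_add_sq_sub_sqrt_le_of_le_half hp hq ht h
  · rw [min_eq_right (by linarith)]
    have := geom_mean_add_sq_sub_sqrt_le_of_le_half hq hp (t := 1 - t) (by linarith) (by linarith)
    rw [sub_sub_cancel] at this
    nlinarith

/-- This quantitative Hölder inequality lets orders below one control the Hellinger distance, as the
relative entropy does for orders at least one. -/
lemma powerSum_add_hellinger_le {s : ℝ} (hs : -1 < s) (hs0 : s < 0) (P Q : PMF α) :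
    powerSum s P Q + min (-s) (1 + s) * hellinger P Q ≤ 1 := by
  have := Finset.sum_le_sum fun a (_ : a ∈ Finset.univ) =>
    geom_mean_add_sq_sub_sqrt_le (pr_nonneg P a) (pr_nonneg Q a) (t := -s)
      (by linarith) (by linarith)
  simp only [sub_neg_eq_add] at this
  rw [Finset.sum_add_distrib, Finset.sum_add_distrib, ← Finset.mul_sum, ← Finset.mul_sum,
    ← Finset.mul_sum, sum_pr, sum_pr] at this
  unfold powerSum hellinger
  linarith

lemma powerSum_le_one {s : ℝ} (hs : -1 < s) (hs0 : s < 0) (P Q : PMF α) : powerSum s P Q ≤ 1 := by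
  have h1 := powerSum_add_hellinger_le hs hs0 P Q
  have h2 := mul_nonneg (show (0 : ℝ) ≤ min (-s) (1 + s) from
    le_min (by linarith) (by linarith)) (hellinger_nonneg P Q)
  linarith

/-- A small Rényi divergence forces a small Hellinger distance. -/
lemma hellinger_le_of_renyiDiv_le {s : ℝ} (hs : -1 < s) {P Q : PMF α} {r : ℝ}
    (h : renyiDiv s P Q ≤ r) :
    hellinger P Q ≤ if s < 0 then -s / min (-s) (1 + s) * r else r := by
  split_ifs with hs0
  · have hc : 0 < min (-s) (1 + s) := lt_min (by linarith) (by linarith)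
    have h1 := powerSum_add_hellinger_le hs hs0 P Q
    rw [renyiDiv, if_neg hs0.ne, sum_rpow_eq_powerSum hs (Or.inl hs0)] at h
    rcases (powerSum_nonneg s P Q).eq_or_lt with h0 | h0
    · rw [← h0, ENNReal.ofReal_zero, ENNReal.log_zero,
        EReal.coe_mul_bot_of_neg (by rw [one_div]; exact inv_lt_zero.2 hs0)] at h
      exact absurd h (by simp)
    · rw [ENNReal.log_ofReal_of_pos h0] at h
      norm_cast at h
      have h2 : s * r ≤ Real.log (powerSum s P Q) := by
        have := mul_le_mul_of_nonpos_left h hs0.le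
        rwa [← mul_assoc, mul_one_div_cancel hs0.ne, one_mul] at this
      -- As `exp (s r) ≥ 1 + s r`, the deficit `1 - powerSum` is at most `-s r`, and it dominates a
      -- multiple of the Hellinger distance.
      have h3 : 1 + s * r ≤ powerSum s P Q := by
        rw [← Real.exp_log h0]
        linarith [Real.add_one_le_exp (s * r), Real.exp_le_exp.2 h2]
      rw [div_mul_eq_mul_div, le_div_iff₀ hc]
      linarith
  · push Not at hs0
    have hac : AbsCont P Q := absCont_of_renyiDiv hs0 (ne_top_of_le_ne_top (EReal.coe_ne_top r) h)
    refine (hellinger_le_klReal hac).trans ?_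
    rcases hs0.eq_or_lt with rfl | hs0
    · rw [renyiDiv, if_pos rfl, relEntropy_eq hac] at h
      exact_mod_cast h
    · rw [renyiDiv_eq hs hs0.ne' hac] at h
      norm_cast at h
      have := (Real.le_log_iff_exp_le (powerSum_pos s hac)).2 (exp_klReal_le_powerSum s hac)
      refine le_trans ?_ h
      rw [one_div, ← div_eq_inv_mul, le_div_iff₀ hs0]
      linarith

lemma klReal_nonneg {P Q : PMF α} (h : AbsCont P Q) : 0 ≤ klReal P Q :=
  (hellinger_nonneg P Q).trans (hellinger_le_klReal h)

lemma one_le_powerSum {s : ℝ} (hs : 0 ≤ s) {P Q : PMF α} (h : AbsCont P Q) :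
    1 ≤ powerSum s P Q :=
  (Real.one_le_exp (mul_nonneg hs (klReal_nonneg h))).trans (exp_klReal_le_powerSum s h)

/-- A single power sum of positive order `s₀` bounds the relative entropy by Jensen, and through it
every order `s ≤ 0`. The random coding bound thus needs to treat only positive orders. -/
lemma renyiDiv_mem_Icc {s s₀ δ : ℝ} (hs : -1 < s) (hs₀ : 0 < s₀) (hss : s = s₀ ∨ s ≤ 0)
    {P Q : PMF α} (hac : AbsCont P Q) (h : powerSum s₀ P Q ≤ 1 + δ) :
    renyiDiv s P Q ∈ Set.Icc 0 ((δ / s₀ : ℝ) : EReal) := by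
  have hlog : Real.log (powerSum s₀ P Q) ≤ δ := by
    have := Real.log_le_sub_one_of_pos (powerSum_pos s₀ hac)
    linarith
  have hkl : klReal P Q ≤ δ / s₀ := by
    rw [le_div_iff₀ hs₀]
    have := (Real.le_log_iff_exp_le (powerSum_pos s₀ hac)).2 (exp_klReal_le_powerSum s₀ hac)
    linarith
  rcases hss with rfl | hs0
  · rw [renyiDiv_eq hs hs₀.ne' hac]
    constructor
    · exact_mod_cast mul_nonneg (by positivity) (Real.log_nonneg (one_le_powerSum hs₀.le hac))
    · norm_cast
      rw [one_div, ← div_eq_inv_mul]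
      gcongr
  · rcases hs0.eq_or_lt with rfl | hs0
    · rw [renyiDiv, if_pos rfl, relEntropy_eq hac]
      exact ⟨by exact_mod_cast klReal_nonneg hac, by exact_mod_cast hkl⟩
    · rw [renyiDiv_eq hs hs0.ne hac]
      constructor
      · exact_mod_cast mul_nonneg_of_nonpos_of_nonpos (one_div_nonpos.2 hs0.le)
          (Real.log_nonpos (powerSum_nonneg _ _ _) (powerSum_le_one hs hs0 P Q))
      · norm_cast
        refine le_trans ?_ hkl
        have := (Real.le_log_iff_exp_le (powerSum_pos s hac)).2 (exp_klReal_le_powerSum s hac)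
        rw [one_div, ← div_eq_inv_mul, div_le_iff_of_neg hs0]
        linarith

/-- The total variation distance is controlled by the Hellinger distance. -/
lemma sum_abs_sub_le (P Q : PMF α) : ∑ a, |pr P a - pr Q a| ≤ 2 * √(hellinger P Q) := by
  have h1 : ∀ a, |pr P a - pr Q a| = |√(pr P a) - √(pr Q a)| * (√(pr P a) + √(pr Q a)) := by
    intro a
    rw [← abs_of_nonneg (show 0 ≤ √(pr P a) + √(pr Q a) by positivity), ← abs_mul]
    congr 1
    nlinarith [Real.sq_sqrt (pr_nonneg P a), Real.sq_sqrt (pr_nonneg Q a)]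
  -- Cauchy–Schwarz on the factorization `p - q = (√p - √q)(√p + √q)`; the second factor has square
  -- sum at most `4`.
  have h2 := Finset.sum_mul_sq_le_sq_mul_sq Finset.univ (fun a => |√(pr P a) - √(pr Q a)|)
    fun a => √(pr P a) + √(pr Q a)
  simp_rw [← h1, sq_abs] at h2
  have h3 : ∑ a, (√(pr P a) + √(pr Q a)) ^ 2 ≤ 4 := by
    calc _ ≤ ∑ a, (2 * pr P a + 2 * pr Q a) := Finset.sum_le_sum fun a _ => by
          nlinarith [Real.sq_sqrt (pr_nonneg P a), Real.sq_sqrt (pr_nonneg Q a),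
            sq_nonneg (√(pr P a) - √(pr Q a))]
      _ = 4 := by
          rw [Finset.sum_add_distrib, ← Finset.mul_sum, ← Finset.mul_sum, sum_pr, sum_pr]
          norm_num
  refine abs_le_of_sq_le_sq' ?_ (by positivity) |>.2
  rw [mul_pow, Real.sq_sqrt (hellinger_nonneg P Q)]
  change _ ≤ hellinger P Q * _ at h2
  nlinarith [hellinger_nonneg P Q]

/-- The part of `P` where it exceeds `4 Q` has mass at most four times the Hellinger distance. -/
lemma sum_ite_four_mul_lt_le (P Q : PMF α) [DecidablePred fun a => 4 * pr Q a < pr P a] :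
    ∑ a, (if 4 * pr Q a < pr P a then pr P a else 0) ≤ 4 * hellinger P Q := by
  unfold hellinger
  rw [Finset.mul_sum]
  refine Finset.sum_le_sum fun a _ => ?_
  split_ifs with h
  -- If `p > 4q` then `√q ≤ √p / 2`, so `(√p - √q) ^ 2 ≥ p / 4`.
  · have h1 : 2 * √(pr Q a) ≤ √(pr P a) := by
      rw [show (2 : ℝ) = √4 by rw [show (4 : ℝ) = 2 ^ 2 by norm_num]; simp,
        ← Real.sqrt_mul (by norm_num)]
      exact Real.sqrt_le_sqrt h.le
    nlinarith [Real.sq_sqrt (pr_nonneg P a), Real.sqrt_nonneg (pr P a), Real.sqrt_nonneg (pr Q a)]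
  · positivity

end Renyi

/-! ### Single-letter quantities as functions on the probability simplex -/

section SingleLetter

variable {X Y Z : Type*} [Fintype X] [Fintype Y] [Fintype Z]

/-- The output weights of a channel for the input weights `v`. -/
noncomputable def outWeight (K : X → PMF Y) (v : X → ℝ) (y : Y) : ℝ := ∑ x, v x * pr (K x) y

/-- The mutual information for the input weights `v`. -/
noncomputable def infoReal (K : X → PMF Y) (v : X → ℝ) : ℝ :=
  ∑ x, v x * ∑ y, pr (K x) y * Real.log (pr (K x) y) + ∑ y, Real.negMulLog (outWeight K v y)

/-- The divergence appearing in the resolvability rate, as a real number. -/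
noncomputable def divReal (s : ℝ) (P Q : PMF Z) : ℝ :=
  if 0 < s then 1 / s * Real.log (powerSum s P Q) else klReal P Q

/-- The resolvability rate for the input weights `v`. -/
noncomputable def rateReal (s : ℝ) (K : X → PMF Z) (Q : PMF Z) (v : X → ℝ) : ℝ :=
  ∑ x, v x * divReal s (K x) Q

lemma pr_mem_stdSimplex (P : PMF X) : pr P ∈ stdSimplex ℝ X := ⟨pr_nonneg P, sum_pr P⟩

lemma exists_pmf_of_mem_stdSimplex {v : X → ℝ} (hv : v ∈ stdSimplex ℝ X) :
    ∃ P : PMF X, pr P = v := by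
  refine ⟨PMF.ofFintype (fun x => ENNReal.ofReal (v x)) ?_, ?_⟩
  · rw [← ENNReal.ofReal_sum_of_nonneg fun x _ => hv.1 x, hv.2, ENNReal.ofReal_one]
  · funext x
    simp [pr, hv.1 x]

lemma outWeight_nonneg (K : X → PMF Y) {v : X → ℝ} (hv : v ∈ stdSimplex ℝ X) (y : Y) :
    0 ≤ outWeight K v y :=
  Finset.sum_nonneg fun x _ => mul_nonneg (hv.1 x) (pr_nonneg _ _)

lemma sum_outWeight (K : X → PMF Y) {v : X → ℝ} (hv : v ∈ stdSimplex ℝ X) :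
    ∑ y, outWeight K v y = 1 := by
  unfold outWeight
  rw [Finset.sum_comm]
  simp_rw [← Finset.mul_sum, sum_pr, mul_one]
  exact hv.2

lemma mul_pr_le_outWeight (K : X → PMF Y) {v : X → ℝ} (hv : v ∈ stdSimplex ℝ X) (x : X) (y : Y) :
    v x * pr (K x) y ≤ outWeight K v y :=
  Finset.single_le_sum (f := fun x => v x * pr (K x) y)
    (fun x _ => mul_nonneg (hv.1 x) (pr_nonneg _ _)) (Finset.mem_univ x)

lemma outWeight_pos (K : X → PMF Y) {v : X → ℝ} (hv : v ∈ stdSimplex ℝ X) {x : X} {y : Y}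
    (hx : 0 < v x) (hy : 0 < pr (K x) y) : 0 < outWeight K v y :=
  (mul_pos hx hy).trans_le (mul_pr_le_outWeight K hv x y)

lemma outWeight_pr (K : X → PMF Y) (P : PMF X) (y : Y) : outWeight K (pr P) y = pr (P.bind K) y :=
  (pr_bind P K y).symm

/-- The definition of `infoReal`, linear part plus output entropy, makes continuity and concavity
visible; this log-likelihood form is the one that Fano's inequality and the decoding test use. Where
the joint weight is positive so is the output weight, and the logarithm splits. -/
lemma infoReal_eq (K : X → PMF Y) {v : X → ℝ} (hv : v ∈ stdSimplex ℝ X) :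
    infoReal K v = ∑ x, v x * ∑ y, pr (K x) y * Real.log (pr (K x) y / outWeight K v y) := by
  have h : ∑ y, Real.negMulLog (outWeight K v y) =
      ∑ x, v x * ∑ y, pr (K x) y * -Real.log (outWeight K v y) := by
    simp_rw [Real.negMulLog_def, Finset.mul_sum]
    rw [Finset.sum_comm]
    refine Finset.sum_congr rfl fun y _ => ?_
    rw [outWeight, neg_mul, Finset.sum_mul, ← Finset.sum_neg_distrib]
    exact Finset.sum_congr rfl fun x _ => by ring
  rw [infoReal, h, ← Finset.sum_add_distrib]
  refine Finset.sum_congr rfl fun x _ => ?_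
  rw [← mul_add, ← Finset.sum_add_distrib]
  rcases (hv.1 x).eq_or_lt with h0 | h0
  · rw [← h0, zero_mul, zero_mul]
  congr 1
  refine Finset.sum_congr rfl fun y _ => ?_
  rcases (pr_nonneg (K x) y).eq_or_lt with h1 | h1
  · simp [← h1]
  · rw [Real.log_div h1.ne' (outWeight_pos K hv h0 h1).ne']
    ring

lemma mutualInfo_eq (P : PMF X) (K : X → PMF Y) : mutualInfo P K = (infoReal K (pr P) : EReal) := by
  have hv := pr_mem_stdSimplex P
  have hac : AbsCont (jointLaw P K) (prodLaw P (P.bind K)) := by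
    rintro ⟨x, y⟩ h
    rw [pr_prodLaw, ← outWeight_pr, mul_eq_zero] at h
    rw [pr_jointLaw]
    rcases h with h | h
    · rw [h, zero_mul]
    · exact le_antisymm ((mul_pr_le_outWeight K hv x y).trans_eq h)
        (mul_nonneg (pr_nonneg _ _) (pr_nonneg _ _))
  rw [mutualInfo, relEntropy_eq hac, infoReal_eq K hv, klReal, Fintype.sum_prod_type]
  congr 1
  refine Finset.sum_congr rfl fun x _ => ?_
  rw [Finset.mul_sum]
  refine Finset.sum_congr rfl fun y _ => ?_
  rw [pr_jointLaw, pr_prodLaw, outWeight_pr, mul_assoc]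
  rcases (pr_nonneg P x).eq_or_lt with h0 | h0
  · rw [← h0, zero_mul, zero_mul]
  · rw [mul_div_mul_left _ _ h0.ne']

lemma mem_inducing_iff {P : PMF X} {K : X → PMF Z} {Q : PMF Z} :
    P ∈ inducing K Q ↔ ∀ z, outWeight K (pr P) z = pr Q z := by
  simp_rw [outWeight_pr]
  exact ⟨fun h z => by rw [show P.bind K = Q from h], fun h => ext_pr h⟩

lemma absCont_of_outWeight {K : X → PMF Z} {Q : PMF Z} {v : X → ℝ} (hv : v ∈ stdSimplex ℝ X)
    (h : ∀ z, outWeight K v z = pr Q z) {x : X} (hx : 0 < v x) : AbsCont (K x) Q := by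
  intro z hz
  by_contra h0
  have := outWeight_pos K hv hx (lt_of_le_of_ne (pr_nonneg (K x) z) (Ne.symm h0))
  rw [h z, hz] at this
  exact lt_irrefl _ this

lemma coe_sum_ereal {ι : Type*} (t : Finset ι) (f : ι → ℝ) :
    ((∑ i ∈ t, f i : ℝ) : EReal) = ∑ i ∈ t, (f i : EReal) := by
  classical
  induction t using Finset.induction_on with
  | empty => simp
  | insert i t hi ih => rw [Finset.sum_insert hi, Finset.sum_insert hi, EReal.coe_add, ih]

lemma coe_ennreal_eq_pr (P : PMF X) (x : X) : ((P x : ℝ≥0∞) : EReal) = (pr P x : EReal) := by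
  rw [← ofReal_pr, EReal.coe_ennreal_ofReal, max_eq_left (pr_nonneg P x)]

/-- An input letter of positive weight has its output law dominated by the mixture `Q`, so its
divergence is finite. Letters of weight zero may have infinite divergence, but `0 * ⊤ = 0`. -/
lemma resolvabilityRate_eq {s : ℝ} {P : PMF X} {K : X → PMF Z} {Q : PMF Z}
    (h : P ∈ inducing K Q) :
    resolvabilityRate s P K Q = (rateReal s K Q (pr P) : EReal) := by
  have hac := fun x => absCont_of_outWeight (x := x) (pr_mem_stdSimplex P) (mem_inducing_iff.1 h)
  unfold resolvabilityRate rateReal divReal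
  simp_rw [coe_ennreal_eq_pr, coe_sum_ereal, EReal.coe_mul]
  split_ifs with hs
  · refine Finset.sum_congr rfl fun x _ => ?_
    rcases (pr_nonneg P x).eq_or_lt with h0 | h0
    · simp [← h0]
    · rw [renyiDiv_eq (by linarith) hs.ne' (hac x h0), EReal.coe_mul]
  · refine Finset.sum_congr rfl fun x _ => ?_
    rcases (pr_nonneg P x).eq_or_lt with h0 | h0
    · simp [← h0]
    · rw [relEntropy_eq (hac x h0)]

lemma mem_singleLetterRegion_iff {W : X → PMF (Y × Z)} {Q : PMF Z} {s : ℝ} {R : ℝ≥0 × ℝ≥0} :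
    R ∈ singleLetterRegion W Q s ↔ ∃ v ∈ stdSimplex ℝ X,
      (∀ z, outWeight (tapChannel W) v z = pr Q z) ∧
      (R.1 : ℝ) + R.2 ≤ infoReal (legitChannel W) v ∧ rateReal s (tapChannel W) Q v ≤ R.1 := by
  simp only [singleLetterRegion, Set.mem_iUnion, Set.mem_ofPred_eq, exists_prop]
  constructor
  · rintro ⟨P, hP, h1, h2⟩
    rw [mutualInfo_eq] at h1
    rw [resolvabilityRate_eq hP] at h2
    exact ⟨pr P, pr_mem_stdSimplex P, mem_inducing_iff.1 hP, by exact_mod_cast h1,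
      by exact_mod_cast h2⟩
  · rintro ⟨v, hv, hQ, h1, h2⟩
    obtain ⟨P, rfl⟩ := exists_pmf_of_mem_stdSimplex hv
    refine ⟨P, mem_inducing_iff.2 hQ, ?_, ?_⟩
    · rw [mutualInfo_eq]
      exact_mod_cast h1
    · rw [resolvabilityRate_eq (mem_inducing_iff.2 hQ)]
      exact_mod_cast h2

lemma continuous_outWeight (K : X → PMF Y) (y : Y) : Continuous fun v => outWeight K v y := by
  unfold outWeight
  fun_prop

lemma continuous_infoReal (K : X → PMF Y) : Continuous (infoReal K) := by
  have := continuous_outWeight K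
  unfold infoReal
  refine .add (by fun_prop) (continuous_finsetSum _ fun y _ => ?_)
  exact Real.continuous_negMulLog.comp (this y)

lemma continuous_rateReal (s : ℝ) (K : X → PMF Z) (Q : PMF Z) : Continuous (rateReal s K Q) := by
  unfold rateReal
  fun_prop

/-- Compactness of the simplex: approximate single-letter bounds pass to the limit. -/
lemma mem_singleLetterRegion_of_tendsto {W : X → PMF (Y × Z)} {Q : PMF Z} {s : ℝ}
    {R : ℝ≥0 × ℝ≥0} {v : ℕ → X → ℝ} {a b e : ℕ → ℝ} (hv : ∀ᶠ k in atTop, v k ∈ stdSimplex ℝ X)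
    (ha : Tendsto a atTop (𝓝 ((R.1 : ℝ) + R.2))) (hb : Tendsto b atTop (𝓝 (R.1 : ℝ)))
    (he : Tendsto e atTop (𝓝 0))
    (h1 : ∀ᶠ k in atTop, a k ≤ infoReal (legitChannel W) (v k))
    (h2 : ∀ᶠ k in atTop, rateReal s (tapChannel W) Q (v k) ≤ b k)
    (h3 : ∀ z, ∀ᶠ k in atTop, |outWeight (tapChannel W) (v k) z - pr Q z| ≤ e k) :
    R ∈ singleLetterRegion W Q s := by
  obtain ⟨w, hw, φ, hφ, hlim⟩ :=
    (isCompact_stdSimplex ℝ X).tendsto_subseq' (x := v) hv.frequently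
  have hφ' := hφ.tendsto_atTop
  rw [mem_singleLetterRegion_iff]
  refine ⟨w, hw, fun z => ?_, ?_, ?_⟩
  · have h4 := (((continuous_outWeight (tapChannel W) z).tendsto w).comp hlim).sub_const (pr Q z)
    have h5 : Tendsto (fun k => outWeight (tapChannel W) (v (φ k)) z - pr Q z) atTop (𝓝 0) :=
      squeeze_zero_norm' (hφ'.eventually (h3 z)) (he.comp hφ')
    linarith [tendsto_nhds_unique h4 h5]
  · exact le_of_tendsto_of_tendsto (ha.comp hφ')
      (((continuous_infoReal (legitChannel W)).tendsto w).comp hlim) (hφ'.eventually h1)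
  · exact le_of_tendsto_of_tendsto (((continuous_rateReal s (tapChannel W) Q).tendsto w).comp hlim)
      (hb.comp hφ') (hφ'.eventually h2)

lemma isClosed_singleLetterRegion (W : X → PMF (Y × Z)) (Q : PMF Z) (s : ℝ) :
    IsClosed (singleLetterRegion W Q s) := by
  rw [← isSeqClosed_iff_isClosed]
  intro R R₀ hR hlim
  have hR' := fun k => mem_singleLetterRegion_iff.1 (hR k)
  choose v hv h1 h2 h3 using hR'
  have l1 : Tendsto (fun k => ((R k).1 : ℝ)) atTop (𝓝 (R₀.1 : ℝ)) :=
    NNReal.tendsto_coe.2 ((continuous_fst.tendsto _).comp hlim)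
  have l2 : Tendsto (fun k => ((R k).2 : ℝ)) atTop (𝓝 (R₀.2 : ℝ)) :=
    NNReal.tendsto_coe.2 ((continuous_snd.tendsto _).comp hlim)
  exact mem_singleLetterRegion_of_tendsto (.of_forall hv) (l1.add l2) l1 tendsto_const_nhds
    (.of_forall h2) (.of_forall h3) (e := fun _ => 0) fun z => .of_forall fun k => by simp [h1 k z]

lemma outWeight_combo (K : X → PMF Y) (v w : X → ℝ) (a b : ℝ) (y : Y) :
    outWeight K (fun x => a * v x + b * w x) y = a * outWeight K v y + b * outWeight K w y := by
  unfold outWeight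
  rw [Finset.mul_sum, Finset.mul_sum, ← Finset.sum_add_distrib]
  exact Finset.sum_congr rfl fun x _ => by ring

lemma rateReal_combo (s : ℝ) (K : X → PMF Z) (Q : PMF Z) (v w : X → ℝ) (a b : ℝ) :
    rateReal s K Q (fun x => a * v x + b * w x) = a * rateReal s K Q v + b * rateReal s K Q w := by
  unfold rateReal
  rw [Finset.mul_sum, Finset.mul_sum, ← Finset.sum_add_distrib]
  exact Finset.sum_congr rfl fun x _ => by ring

/-- Concavity of the mutual information in the input distribution. -/
lemma infoReal_combo_ge (K : X → PMF Y) {v w : X → ℝ} (hv : v ∈ stdSimplex ℝ X)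
    (hw : w ∈ stdSimplex ℝ X) {a b : ℝ} (ha : 0 ≤ a) (hb : 0 ≤ b) (hab : a + b = 1) :
    a * infoReal K v + b * infoReal K w ≤ infoReal K fun x => a * v x + b * w x := by
  unfold infoReal
  rw [mul_add, mul_add, add_add_add_comm]
  refine add_le_add (le_of_eq ?_) ?_
  · rw [Finset.mul_sum, Finset.mul_sum, ← Finset.sum_add_distrib]
    exact Finset.sum_congr rfl fun x _ => by ring
  · rw [Finset.mul_sum, Finset.mul_sum, ← Finset.sum_add_distrib]
    refine Finset.sum_le_sum fun y _ => ?_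
    rw [outWeight_combo]
    have := Real.concaveOn_negMulLog.2 (x := outWeight K v y) (y := outWeight K w y)
      (outWeight_nonneg K hv y) (outWeight_nonneg K hw y) ha hb hab
    simpa using this

/-- Convexity of the single-letter region. -/
lemma combo_mem_singleLetterRegion {W : X → PMF (Y × Z)} {Q : PMF Z} {s : ℝ} {R R' : ℝ≥0 × ℝ≥0}
    (hR : R ∈ singleLetterRegion W Q s) (hR' : R' ∈ singleLetterRegion W Q s) {a b : ℝ≥0}
    (hab : a + b = 1) : a • R + b • R' ∈ singleLetterRegion W Q s := by
  rw [mem_singleLetterRegion_iff] at *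
  obtain ⟨v, hv, h1, h2, h3⟩ := hR
  obtain ⟨w, hw, h1', h2', h3'⟩ := hR'
  have hab' : (a : ℝ) + b = 1 := by exact_mod_cast hab
  refine ⟨fun x => a * v x + b * w x, ?_, fun z => ?_, ?_, ?_⟩
  · exact convex_stdSimplex ℝ X hv hw a.2 b.2 hab'
  · rw [outWeight_combo, h1, h1', ← add_mul, hab', one_mul]
  · refine le_trans ?_ (infoReal_combo_ge _ hv hw a.2 b.2 hab')
    have e1 := mul_le_mul_of_nonneg_left h2 a.2
    have e2 := mul_le_mul_of_nonneg_left h2' b.2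
    simp only [Prod.fst_add, Prod.snd_add, Prod.smul_fst, Prod.smul_snd, smul_eq_mul,
      NNReal.coe_add, NNReal.coe_mul]
    simp only [NNReal.val_eq_coe] at e1 e2 ⊢
    linarith
  · rw [rateReal_combo]
    have e1 := mul_le_mul_of_nonneg_left h3 a.2
    have e2 := mul_le_mul_of_nonneg_left h3' b.2
    simp only [NNReal.val_eq_coe] at e1 e2
    simpa using add_le_add e1 e2

end SingleLetter

/-! ### The converse -/

section Converse

/-- Write `x ^ (1 + s) = x * x ^ s` and bound each `a i ^ s` by the power of the whole sum. -/
lemma sum_rpow_le_rpow_sum {ι : Type*} (t : Finset ι) {a : ι → ℝ} (ha : ∀ i, 0 ≤ a i) {s : ℝ}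
    (hs : 0 ≤ s) : ∑ i ∈ t, a i ^ (1 + s) ≤ (∑ i ∈ t, a i) ^ (1 + s) := by
  have hS : 0 ≤ ∑ i ∈ t, a i := Finset.sum_nonneg fun i _ => ha i
  have e : ∀ x : ℝ, 0 ≤ x → x ^ (1 + s) = x * x ^ s := fun x hx => by
    rw [Real.rpow_add_of_nonneg hx zero_le_one hs, Real.rpow_one]
  rw [e _ hS, Finset.sum_mul]
  refine Finset.sum_le_sum fun i hi => ?_
  rw [e _ (ha i)]
  exact mul_le_mul_of_nonneg_left
    (Real.rpow_le_rpow (ha i) (Finset.single_le_sum (fun j _ => ha j) hi) hs) (ha i)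

namespace DetCode

variable {X Y Z : Type*} [Fintype X] [Fintype Y] [Fintype Z] {n k₀ k₁ : ℕ} [NeZero k₀] [NeZero k₁]
  (C : DetCode X Y n k₀ k₁) (W : X → PMF (Y × Z)) (Q : PMF Z)

/-- The empirical distribution of all letters of the codebook. -/
noncomputable def letterFreq (x : X) : ℝ :=
  open Classical in
  ((k₀ : ℝ) * k₁ * n)⁻¹ * ∑ m, ∑ i, if C.encode m i = x then 1 else 0

lemma sum_letterFreq_mul (f : X → ℝ) :
    ∑ x, C.letterFreq x * f x = ((k₀ : ℝ) * k₁ * n)⁻¹ * ∑ m, ∑ i, f (C.encode m i) := by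
  classical
  unfold letterFreq
  simp_rw [mul_assoc _ _ (f _), ← Finset.mul_sum, Finset.sum_mul]
  congr 1
  rw [Finset.sum_comm]
  refine Finset.sum_congr rfl fun m _ => ?_
  rw [Finset.sum_comm]
  refine Finset.sum_congr rfl fun i _ => ?_
  simp

lemma letterFreq_mem_stdSimplex (hn : n ≠ 0) : C.letterFreq ∈ stdSimplex ℝ X := by
  refine ⟨fun x => ?_, ?_⟩
  · unfold letterFreq
    refine mul_nonneg (by positivity) (Finset.sum_nonneg fun m _ => Finset.sum_nonneg fun i _ => ?_)
    split_ifs <;> norm_num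
  · have h := C.sum_letterFreq_mul fun _ => 1
    have h0 : (k₀ : ℝ) ≠ 0 := NeZero.ne _
    have h1 : (k₁ : ℝ) ≠ 0 := NeZero.ne _
    have h2 : (n : ℝ) ≠ 0 := by exact_mod_cast hn
    simp only [mul_one, Finset.sum_const, Finset.card_univ, Fintype.card_prod, Fintype.card_fin,
      nsmul_eq_mul] at h
    rw [h]
    push_cast
    field_simp

lemma letterFreq_pos (m : Fin k₀ × Fin k₁) (i : Fin n) : 0 < C.letterFreq (C.encode m i) := by
  classical
  have h0 : 0 < (k₀ : ℝ) := Nat.cast_pos.2 (NeZero.pos _)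
  have h1 : 0 < (k₁ : ℝ) := Nat.cast_pos.2 (NeZero.pos _)
  have h2 : 0 < (n : ℝ) := Nat.cast_pos.2 (Fin.pos i)
  unfold letterFreq
  refine mul_pos (by positivity) ?_
  have nn : ∀ m' (i' : Fin n), (0 : ℝ) ≤ if C.encode m' i' = C.encode m i then 1 else 0 := by
    intro m' i'
    split_ifs <;> norm_num
  refine lt_of_lt_of_le ?_ (Finset.single_le_sum
    (fun m' _ => Finset.sum_nonneg fun i' _ => nn m' i') (Finset.mem_univ m))
  refine lt_of_lt_of_le ?_ (Finset.single_le_sum (fun i' _ => nn m i') (Finset.mem_univ i))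
  simp

/-- The law `P_{M₁} Q_Z^n` that the eavesdropper's law is compared with. -/
noncomputable def idealLaw : PMF (Fin k₁ × (Fin n → Z)) :=
  prodLaw ((C.secretTapLaw W).map Prod.fst) (iidLaw Q n)

lemma sum_secretTapLaw_mul (f : Fin k₁ × (Fin n → Z) → ℝ) :
    ∑ p, pr (C.secretTapLaw W) p * f p = ((k₀ : ℝ) * k₁)⁻¹ *
      ∑ m : Fin k₀ × Fin k₁, ∑ z, (∏ i, pr (tapChannel W (C.encode m i)) (z i)) * f (m.2, z) := by
  rw [Fintype.sum_prod_type, Fintype.sum_prod_type, Finset.sum_comm (f := fun (l : Fin k₀) _ => _),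
    Finset.mul_sum]
  refine Finset.sum_congr rfl fun j _ => ?_
  simp_rw [pr_secretTapLaw, Finset.sum_mul]
  rw [Finset.sum_comm, Finset.mul_sum]
  refine Finset.sum_congr rfl fun l _ => ?_
  rw [Finset.mul_sum]
  exact Finset.sum_congr rfl fun z _ => by ring

lemma sum_idealLaw_mul_ite [DecidableEq Z] (i : Fin n) (z₀ : Z) :
    ∑ p, pr (C.idealLaw W Q) p * (if p.2 i = z₀ then 1 else 0) = pr Q z₀ := by
  have h1 : (k₁ : ℝ) ≠ 0 := NeZero.ne _
  rw [Fintype.sum_prod_type]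
  unfold idealLaw
  simp_rw [pr_secretTapLaw_prod, mul_assoc, ← Finset.mul_sum]
  have h : ∑ z : Fin n → Z, (∏ j, pr Q (z j)) * (if z i = z₀ then 1 else 0) = pr Q z₀ := by
    rw [sum_pi_prod_mul (w := fun _ => pr Q) (fun _ => sum_pr Q) i
      fun z => if z = z₀ then 1 else 0]
    simp
  rw [Finset.sum_congr rfl fun _ _ => h]
  simp
  field_simp

lemma sum_secretTapLaw_mul_ite [DecidableEq Z] (i : Fin n) (z₀ : Z) :
    ∑ p, pr (C.secretTapLaw W) p * (if p.2 i = z₀ then 1 else 0) =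
      ((k₀ : ℝ) * k₁)⁻¹ * ∑ m, pr (tapChannel W (C.encode m i)) z₀ := by
  rw [sum_secretTapLaw_mul]
  congr 1
  refine Finset.sum_congr rfl fun m _ => ?_
  simp only
  rw [sum_pi_prod_mul (w := fun i => pr (tapChannel W (C.encode m i))) (fun _ => sum_pr _) i
    fun z => if z = z₀ then 1 else 0]
  simp

/-- The single-letter output distribution is close to `Q`. -/
lemma abs_outWeight_letterFreq_sub_le (hn : n ≠ 0) (z₀ : Z) :
    |outWeight (tapChannel W) C.letterFreq z₀ - pr Q z₀| ≤
      2 * √(hellinger (C.secretTapLaw W) (C.idealLaw W Q)) := by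
  classical
  have hn' : (0 : ℝ) < n := by positivity
  have h : outWeight (tapChannel W) C.letterFreq z₀ - pr Q z₀ =
      (n : ℝ)⁻¹ * ∑ i : Fin n, ∑ p, (pr (C.secretTapLaw W) p - pr (C.idealLaw W Q) p) *
        (if p.2 i = z₀ then 1 else 0) := by
    simp_rw [sub_mul, Finset.sum_sub_distrib, sum_idealLaw_mul_ite, sum_secretTapLaw_mul_ite]
    rw [outWeight, C.sum_letterFreq_mul fun x => pr (tapChannel W x) z₀, ← Finset.mul_sum,
      Finset.sum_comm]
    simp
    field_simp
  rw [h, abs_mul, abs_of_pos (inv_pos.2 hn'), inv_mul_le_iff₀ hn']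
  calc _ ≤ ∑ i : Fin n, |∑ p, (pr (C.secretTapLaw W) p - pr (C.idealLaw W Q) p) *
        (if p.2 i = z₀ then 1 else 0)| := Finset.abs_sum_le_sum_abs _ _
    _ ≤ ∑ i : Fin n, 2 * √(hellinger (C.secretTapLaw W) (C.idealLaw W Q)) := by
        refine Finset.sum_le_sum fun i _ => (Finset.abs_sum_le_sum_abs _ _).trans ?_
        refine le_trans (Finset.sum_le_sum fun p _ => ?_) (sum_abs_sub_le _ _)
        split_ifs <;> simp
    _ = _ := by simp

lemma mul_rateReal_letterFreq (hn : n ≠ 0) (s : ℝ) :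
    n * rateReal s (tapChannel W) Q C.letterFreq = ((k₀ : ℝ) * k₁)⁻¹ *
      ∑ m, ∑ i, divReal s (tapChannel W (C.encode m i)) Q := by
  have hn' : (n : ℝ) ≠ 0 := by exact_mod_cast hn
  rw [rateReal, C.sum_letterFreq_mul fun x => divReal s (tapChannel W x) Q, mul_inv]
  field_simp

lemma prod_tap_le (m : Fin k₀ × Fin k₁) (z : Fin n → Z) :
    ((k₀ : ℝ) * k₁)⁻¹ * ∏ i, pr (tapChannel W (C.encode m i)) (z i) ≤
      pr (C.secretTapLaw W) (m.2, z) := by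
  rw [pr_secretTapLaw]
  exact Finset.single_le_sum (f := fun l => ((k₀ : ℝ) * k₁)⁻¹ *
    ∏ i, pr (tapChannel W (C.encode (l, m.2) i)) (z i)) (fun l _ => mul_nonneg (by positivity)
      (Finset.prod_nonneg fun i _ => pr_nonneg _ _)) (Finset.mem_univ m.1)

/-- The resolvability rate bound for the relative entropy, from a small Hellinger distance. -/
lemma mul_rateReal_le_of_nonpos (hn : n ≠ 0) {s : ℝ} (hs : s ≤ 0) {c : ℝ}
    (hc : ∀ x z, Real.log (pr (tapChannel W x) z / pr Q z) ≤ c) (hc0 : 0 ≤ c) :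
    n * rateReal s (tapChannel W) Q C.letterFreq ≤ Real.log k₀ + Real.log 4 +
      c * n * (4 * hellinger (C.secretTapLaw W) (C.idealLaw W Q)) := by
  classical
  have h0 : 0 < (k₀ : ℝ) := Nat.cast_pos.2 (NeZero.pos _)
  have h1 : 0 < (k₁ : ℝ) := Nat.cast_pos.2 (NeZero.pos _)
  have h0' : 0 ≤ Real.log k₀ := Real.log_natCast_nonneg _
  have h4 : 0 ≤ Real.log 4 := Real.log_nonneg (by norm_num)
  set P := C.secretTapLaw W with hP
  set R := C.idealLaw W Q with hR
  rw [mul_rateReal_letterFreq C W Q hn]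
  have key : ∀ m (z : Fin n → Z), (∏ i, pr (tapChannel W (C.encode m i)) (z i)) *
      (∑ i, Real.log (pr (tapChannel W (C.encode m i)) (z i) / pr Q (z i))) ≤
      (∏ i, pr (tapChannel W (C.encode m i)) (z i)) * (Real.log k₀ + Real.log 4 + c * n *
        if 4 * pr R (m.2, z) < pr P (m.2, z) then 1 else 0) := by
    intro m z
    rcases (Finset.prod_nonneg fun i (_ : i ∈ Finset.univ) =>
      pr_nonneg (tapChannel W (C.encode m i)) (z i)).eq_or_lt with hz | hz
    · rw [← hz, zero_mul, zero_mul]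
    refine mul_le_mul_of_nonneg_left ?_ hz.le
    -- On the exceptional event only the crude bound `c` per letter is available. Off it, the
    -- codeword law is at most `k₀ k₁ P ≤ 4 k₀ k₁ R = 4 k₀ Q^n`, which bounds the log-likelihood
    -- ratio by `log k₀ + log 4`.
    split_ifs with hA
    · have : ∑ i, Real.log (pr (tapChannel W (C.encode m i)) (z i) / pr Q (z i)) ≤ ∑ i : Fin n, c :=
        Finset.sum_le_sum fun i _ => hc _ _
      simp at this
      nlinarith
    · push Not at hA
      have hle := (C.prod_tap_le W m z).trans hA
      rw [hR, idealLaw, pr_secretTapLaw_prod, mul_inv] at hle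
      have hle' : ∏ i, pr (tapChannel W (C.encode m i)) (z i) ≤ k₀ * 4 * ∏ i, pr Q (z i) := by
        field_simp at hle
        linarith
      have hQ : 0 < ∏ i, pr Q (z i) := by
        by_contra hcon
        nlinarith [mul_pos h0 (show (0 : ℝ) < 4 by norm_num)]
      rw [← Real.log_prod, Finset.prod_div_distrib, mul_zero, add_zero, ← Real.log_mul h0.ne'
        (by norm_num)]
      · refine Real.log_le_log (div_pos hz hQ) ?_
        rwa [div_le_iff₀ hQ]
      · intro i _
        exact div_ne_zero (Finset.prod_ne_zero_iff.1 hz.ne' i (Finset.mem_univ i))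
          (Finset.prod_ne_zero_iff.1 hQ.ne' i (Finset.mem_univ i))
  have e1 : ∀ m, ∑ i, divReal s (tapChannel W (C.encode m i)) Q = ∑ z : Fin n → Z,
      (∏ i, pr (tapChannel W (C.encode m i)) (z i)) *
      (∑ i, Real.log (pr (tapChannel W (C.encode m i)) (z i) / pr Q (z i))) := by
    intro m
    rw [sum_pi_prod_mul_sum (w := fun i => pr (tapChannel W (C.encode m i))) (fun _ => sum_pr _)
      fun i b => Real.log (pr (tapChannel W (C.encode m i)) b / pr Q b)]
    exact Finset.sum_congr rfl fun i _ => by rw [divReal, if_neg (not_lt.2 hs), klReal]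
  simp_rw [e1]
  calc _ ≤ ((k₀ : ℝ) * k₁)⁻¹ * ∑ m : Fin k₀ × Fin k₁, ∑ z : Fin n → Z,
        (∏ i, pr (tapChannel W (C.encode m i)) (z i)) * (Real.log k₀ + Real.log 4 + c * n *
        if 4 * pr R (m.2, z) < pr P (m.2, z) then 1 else 0) := by
        refine mul_le_mul_of_nonneg_left ?_ (by positivity)
        exact Finset.sum_le_sum fun m _ => Finset.sum_le_sum fun z _ => key m z
    _ = ∑ p, pr P p * (Real.log k₀ + Real.log 4 + c * n *
        if 4 * pr R p < pr P p then 1 else 0) := (C.sum_secretTapLaw_mul W fun p =>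
          Real.log k₀ + Real.log 4 + c * n * if 4 * pr R p < pr P p then 1 else 0).symm
    _ = Real.log k₀ + Real.log 4 + c * n * ∑ p, (if 4 * pr R p < pr P p then pr P p else 0) := by
        simp_rw [mul_add, Finset.sum_add_distrib, ← Finset.sum_mul, sum_pr, one_mul,
          Finset.mul_sum]
        congr 1
        refine Finset.sum_congr rfl fun p _ => ?_
        split_ifs <;> ring
    _ ≤ _ := by
        gcongr
        exact sum_ite_four_mul_lt_le P R

/-- Every codeword is sent with positive probability, so an output letter outside the support of `Q`
would occur in some output sequence of positive probability, which `Q_Z^n` excludes. -/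
lemma absCont_tapChannel (h : AbsCont (C.secretTapLaw W) (C.idealLaw W Q))
    (m : Fin k₀ × Fin k₁) (i : Fin n) : AbsCont (tapChannel W (C.encode m i)) Q := by
  have h0 : 0 < (k₀ : ℝ) := Nat.cast_pos.2 (NeZero.pos _)
  have h1 : 0 < (k₁ : ℝ) := Nat.cast_pos.2 (NeZero.pos _)
  intro z₀ hz
  by_contra hK
  obtain ⟨z, hzi, hz'⟩ := exists_pi_prod_pos (w := fun i => pr (tapChannel W (C.encode m i)))
    (fun _ => sum_pr _) i (lt_of_le_of_ne (pr_nonneg _ z₀) (Ne.symm hK))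
  have := h (m.2, z) (by
    rw [idealLaw, pr_secretTapLaw_prod, Finset.prod_eq_zero (Finset.mem_univ i) (by rw [hzi, hz]),
      mul_zero])
  have h' := C.prod_tap_le W m z
  rw [this] at h'
  exact absurd h' (not_le.2 (by positivity))

/-- The normalizations combine as `(k₀ k₁) ^ (-(1 + s)) * k₁ ^ s = k₀ ^ (-s) * (k₀ k₁)⁻¹`, and the
rest factors over letters. This quantity is the lower bound in the converse and the leading term in
random coding. -/
lemma sum_rpow_codeword_eq (s : ℝ) :
    ∑ j : Fin k₁, ∑ z : Fin n → Z, ∑ l : Fin k₀,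
      (((k₀ : ℝ) * k₁)⁻¹ * ∏ i, pr (tapChannel W (C.encode (l, j) i)) (z i)) ^ (1 + s) *
        ((k₁ : ℝ)⁻¹ * ∏ i, pr Q (z i)) ^ (-s) =
      (k₀ : ℝ) ^ (-s) * (((k₀ : ℝ) * k₁)⁻¹ *
        ∑ m, ∏ i, powerSum s (tapChannel W (C.encode m i)) Q) := by
  have h0 : 0 < (k₀ : ℝ) := Nat.cast_pos.2 (NeZero.pos _)
  have h1 : 0 < (k₁ : ℝ) := Nat.cast_pos.2 (NeZero.pos _)
  have e : ∀ (j : Fin k₁) (z : Fin n → Z) (l : Fin k₀),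
      (((k₀ : ℝ) * k₁)⁻¹ * ∏ i, pr (tapChannel W (C.encode (l, j) i)) (z i)) ^ (1 + s) *
        ((k₁ : ℝ)⁻¹ * ∏ i, pr Q (z i)) ^ (-s) =
      (k₀ : ℝ) ^ (-s) * (((k₀ : ℝ) * k₁)⁻¹ *
        ∏ i, (pr (tapChannel W (C.encode (l, j) i)) (z i) ^ (1 + s) * pr Q (z i) ^ (-s))) := by
    intro j z l
    have hK : 0 ≤ ∏ i, pr (tapChannel W (C.encode (l, j) i)) (z i) :=
      Finset.prod_nonneg fun i _ => pr_nonneg _ _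
    have hQ : 0 ≤ ∏ i, pr Q (z i) := Finset.prod_nonneg fun i _ => pr_nonneg _ _
    rw [Finset.prod_mul_distrib, Real.finsetProd_rpow _ _ fun i _ => pr_nonneg _ _,
      Real.finsetProd_rpow _ _ fun i _ => pr_nonneg _ _, Real.mul_rpow (by positivity) hK,
      Real.mul_rpow (by positivity) hQ]
    have : (((k₀ : ℝ) * k₁)⁻¹) ^ (1 + s) * ((k₁ : ℝ)⁻¹) ^ (-s) =
        (k₀ : ℝ) ^ (-s) * ((k₀ : ℝ) * k₁)⁻¹ := by
      rw [Real.rpow_add (by positivity), Real.rpow_one, mul_inv,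
        Real.mul_rpow (by positivity) (by positivity), Real.rpow_neg h0.le,
        Real.inv_rpow h0.le, Real.inv_rpow h1.le, Real.inv_rpow h1.le, Real.rpow_neg h1.le]
      have := Real.rpow_pos_of_pos h1 s
      field_simp
    linear_combination (∏ i, pr (tapChannel W (C.encode (l, j) i)) (z i)) ^ (1 + s) *
      (∏ i, pr Q (z i)) ^ (-s) * this
  have e2 : ∀ m, ∏ i, powerSum s (tapChannel W (C.encode m i)) Q = ∑ z : Fin n → Z,
      ∏ i, (pr (tapChannel W (C.encode m i)) (z i) ^ (1 + s) * pr Q (z i) ^ (-s)) := fun m =>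
    (sum_pi_prod fun i b => pr (tapChannel W (C.encode m i)) b ^ (1 + s) * pr Q b ^ (-s)).symm
  simp_rw [e, e2, Finset.mul_sum]
  rw [Fintype.sum_prod_type, Finset.sum_comm (f := fun (l : Fin k₀) _ => _)]
  exact Finset.sum_congr rfl fun j _ => Finset.sum_comm

/-- The power sum of a code is at least `k₀^{-s}` times the average of those of the codewords. -/
lemma le_powerSum_secretTapLaw {s : ℝ} (hs : 0 < s) :
    (k₀ : ℝ) ^ (-s) * (((k₀ : ℝ) * k₁)⁻¹ * ∑ m, ∏ i, powerSum s (tapChannel W (C.encode m i)) Q) ≤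
      powerSum s (C.secretTapLaw W) (C.idealLaw W Q) := by
  rw [← sum_rpow_codeword_eq, powerSum, Fintype.sum_prod_type]
  refine Finset.sum_le_sum fun j _ => Finset.sum_le_sum fun z _ => ?_
  simp_rw [← Finset.sum_mul, pr_secretTapLaw, idealLaw, pr_secretTapLaw_prod]
  refine mul_le_mul_of_nonneg_right ?_ (Real.rpow_nonneg (mul_nonneg (by positivity)
    (Finset.prod_nonneg fun i _ => pr_nonneg _ _)) _)
  exact sum_rpow_le_rpow_sum _ (fun l => mul_nonneg (by positivity)
    (Finset.prod_nonneg fun i _ => pr_nonneg _ _)) hs.le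

/-- The resolvability rate bound for orders above one. -/
lemma mul_rateReal_le_of_pos (hn : n ≠ 0) {s : ℝ} (hs : 0 < s) {r : ℝ}
    (hr : renyiDiv s (C.secretTapLaw W) (C.idealLaw W Q) ≤ r) :
    n * rateReal s (tapChannel W) Q C.letterFreq ≤ Real.log k₀ + r := by
  have h0 : 0 < (k₀ : ℝ) := Nat.cast_pos.2 (NeZero.pos _)
  have h1 : 0 < (k₁ : ℝ) := Nat.cast_pos.2 (NeZero.pos _)
  have hac := absCont_of_renyiDiv hs.le (ne_top_of_le_ne_top (EReal.coe_ne_top r) hr)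
  have hac' := C.absCont_tapChannel W Q hac
  rw [renyiDiv_eq (by linarith) hs.ne' hac] at hr
  norm_cast at hr
  have hlog : Real.log (powerSum s (C.secretTapLaw W) (C.idealLaw W Q)) ≤ s * r := by
    rwa [one_div, inv_mul_le_iff₀ hs] at hr
  have hle := C.le_powerSum_secretTapLaw W Q hs
  have e : ∀ m, ∏ i, powerSum s (tapChannel W (C.encode m i)) Q =
      Real.exp (s * ∑ i, divReal s (tapChannel W (C.encode m i)) Q) := by
    intro m
    rw [Finset.mul_sum, Real.exp_sum]
    refine Finset.prod_congr rfl fun i _ => ?_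
    rw [divReal, if_pos hs, ← mul_assoc, mul_one_div_cancel hs.ne', one_mul,
      Real.exp_log (powerSum_pos s (hac' m i))]
  -- Jensen for `exp` moves the average over codewords into the exponent, where it becomes `s * n`
  -- times the resolvability rate at the letter frequencies.
  have jensen := convexOn_exp.map_sum_le (t := Finset.univ)
    (w := fun _ : Fin k₀ × Fin k₁ => ((k₀ : ℝ) * k₁)⁻¹)
    (p := fun m => s * ∑ i, divReal s (tapChannel W (C.encode m i)) Q)
    (fun _ _ => by positivity) (by simp; field_simp) (fun _ _ => Set.mem_univ _)
  simp only [smul_eq_mul, ← Finset.mul_sum] at jensen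
  rw [mul_left_comm, ← mul_rateReal_letterFreq C W Q hn] at jensen
  simp_rw [e] at hle
  have h2 := (mul_le_mul_of_nonneg_left jensen (Real.rpow_nonneg h0.le (-s))).trans hle
  rw [Real.rpow_def_of_pos h0, ← Real.exp_add] at h2
  have h3 := ((Real.le_log_iff_exp_le (powerSum_pos s hac)).2 h2).trans hlog
  nlinarith

/-- Fano's inequality, in single-letter form. -/
lemma one_sub_error_mul_log_le (hn : n ≠ 0) :
    (1 - ((k₀ : ℝ) * k₁)⁻¹ * ∑ m, ∑ y : Fin n → Y,
      (∏ i, pr (legitChannel W (C.encode m i)) (y i)) * (1 - pr (C.decode y) m)) *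
      Real.log ((k₀ : ℝ) * k₁) ≤
    n * infoReal (legitChannel W) C.letterFreq + Real.log 2 := by
  have h0 : 0 < (k₀ : ℝ) := Nat.cast_pos.2 (NeZero.pos _)
  have h1 : 0 < (k₁ : ℝ) := Nat.cast_pos.2 (NeZero.pos _)
  have hn' : (n : ℝ) ≠ 0 := by exact_mod_cast hn
  have hv := C.letterFreq_mem_stdSimplex hn
  set v := C.letterFreq
  set K := legitChannel W
  set N : ℝ := (k₀ : ℝ) * k₁ with hN
  have hNpos : 0 < N := by positivity
  have hsum : ∀ m, ∑ y : Fin n → Y, ∏ i, pr (K (C.encode m i)) (y i) = 1 := by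
    intro m
    rw [sum_pi_prod fun i => pr (K (C.encode m i))]
    simp [sum_pr]
  have hcard : ∑ _m : Fin k₀ × Fin k₁, (1 : ℝ) = N := by simp [hN]
  have hout : ∑ y : Fin n → Y, ∏ i, outWeight K v (y i) = 1 := by
    rw [sum_pi_prod fun _ => outWeight K v]
    simp [sum_outWeight K hv]
  have hinfo : n * infoReal K v = N⁻¹ * ∑ m, ∑ y : Fin n → Y,
      (∏ i, pr (K (C.encode m i)) (y i)) *
        ∑ i, Real.log (pr (K (C.encode m i)) (y i) / outWeight K v (y i)) := by
    rw [infoReal_eq K hv, C.sum_letterFreq_mul fun x =>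
      ∑ y, pr (K x) y * Real.log (pr (K x) y / outWeight K v y), mul_inv]
    rw [mul_comm N⁻¹, ← mul_assoc, ← mul_assoc, mul_inv_cancel₀ hn', one_mul]
    congr 1
    refine Finset.sum_congr rfl fun m _ => ?_
    exact (sum_pi_prod_mul_sum (w := fun i => pr (K (C.encode m i))) (fun _ => sum_pr _)
      fun i b => Real.log (pr (K (C.encode m i)) b / outWeight K v b)).symm
  -- This is `log x ≤ x - 1` at `x = R N ^ d / (2 P)`, with `P` the codeword law, `R` the product
  -- output law and `d` the decoding probability. Since `d` sums to one over `m`, the factor `1 / 2`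
  -- makes the right side sum to exactly zero.
  have key : ∀ m (y : Fin n → Y), (∏ i, pr (K (C.encode m i)) (y i)) *
      (pr (C.decode y) m * Real.log N - (∑ i, Real.log (pr (K (C.encode m i)) (y i) /
        outWeight K v (y i))) - Real.log 2) ≤
      (∏ i, outWeight K v (y i)) * (1 + N * pr (C.decode y) m) / 2 -
        ∏ i, pr (K (C.encode m i)) (y i) := by
    intro m y
    have hR : 0 ≤ ∏ i, outWeight K v (y i) := Finset.prod_nonneg fun i _ => outWeight_nonneg K hv _
    have hd := pr_nonneg (C.decode y) m
    rcases (Finset.prod_nonneg fun i (_ : i ∈ Finset.univ) =>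
      pr_nonneg (K (C.encode m i)) (y i)).eq_or_lt with hz | hz
    · rw [← hz, zero_mul, sub_zero]
      positivity
    have hKi : ∀ i, 0 < pr (K (C.encode m i)) (y i) := fun i =>
      lt_of_le_of_ne (pr_nonneg _ _) (Ne.symm (Finset.prod_ne_zero_iff.1 hz.ne' i
        (Finset.mem_univ i)))
    have hRi : ∀ i, 0 < outWeight K v (y i) := fun i =>
      outWeight_pos K hv (C.letterFreq_pos m i) (hKi i)
    have hR : 0 < ∏ i, outWeight K v (y i) := Finset.prod_pos fun i _ => hRi i
    have hpow : 0 < N ^ pr (C.decode y) m := Real.rpow_pos_of_pos hNpos _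
    have hlog := Real.log_le_sub_one_of_pos (x := (∏ i, outWeight K v (y i)) *
      N ^ pr (C.decode y) m / (2 * ∏ i, pr (K (C.encode m i)) (y i))) (by positivity)
    rw [Real.log_div (by positivity) (by positivity), Real.log_mul hR.ne' hpow.ne',
      Real.log_mul (by norm_num) hz.ne', Real.log_rpow hNpos] at hlog
    rw [← Real.log_prod fun i _ => (div_pos (hKi i) (hRi i)).ne', Finset.prod_div_distrib,
      Real.log_div hz.ne' hR.ne']
    -- Bernoulli's inequality makes the bound linear in `d`, which accommodates stochastic decoders.
    have hpow' : N ^ pr (C.decode y) m ≤ 1 + N * pr (C.decode y) m := by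
      have := rpow_one_add_le_one_add_mul_self (s := N - 1) (by linarith) hd (pr_le_one _ m)
      rw [add_sub_cancel] at this
      nlinarith
    have h5 := mul_le_mul_of_nonneg_left hlog hz.le
    have h6 : (∏ i, pr (K (C.encode m i)) (y i)) * ((∏ i, outWeight K v (y i)) *
      N ^ pr (C.decode y) m / (2 * ∏ i, pr (K (C.encode m i)) (y i)) - 1) =
      (∏ i, outWeight K v (y i)) * N ^ pr (C.decode y) m / 2 -
        ∏ i, pr (K (C.encode m i)) (y i) := by
      field_simp
    rw [h6] at h5
    have h7 := mul_le_mul_of_nonneg_left hpow' hR.le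
    linarith
  have total := Finset.sum_le_sum fun m (_ : m ∈ Finset.univ) =>
    Finset.sum_le_sum fun y (_ : y ∈ Finset.univ) => key m y
  simp_rw [Finset.sum_sub_distrib, hsum, hcard] at total
  have hright : ∑ m, ∑ y : Fin n → Y,
      (∏ i, outWeight K v (y i)) * (1 + N * pr (C.decode y) m) / 2 = N := by
    rw [Finset.sum_comm]
    have : ∀ y : Fin n → Y, ∑ m, (∏ i, outWeight K v (y i)) * (1 + N * pr (C.decode y) m) / 2 =
        (∏ i, outWeight K v (y i)) * N := by
      intro y
      rw [← Finset.sum_div, ← Finset.mul_sum, Finset.sum_add_distrib, hcard, ← Finset.mul_sum,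
        sum_pr]
      ring
    simp_rw [this]
    rw [← Finset.sum_mul, hout, one_mul]
  rw [hright, sub_self] at total
  simp_rw [mul_sub, Finset.sum_sub_distrib, ← Finset.sum_mul, hsum, hcard] at total
  simp_rw [mul_sub, Finset.sum_sub_distrib, mul_one, hsum, hcard]
  rw [hinfo]
  simp_rw [← mul_assoc, ← Finset.sum_mul] at total
  rw [mul_sub, inv_mul_cancel₀ hNpos.ne', sub_sub_cancel]
  have h8 := mul_le_mul_of_nonneg_left total (inv_nonneg.2 hNpos.le)
  rw [mul_zero, mul_sub, mul_sub, ← mul_assoc N⁻¹ N, inv_mul_cancel₀ hNpos.ne', one_mul,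
    ← mul_assoc] at h8
  linarith

end DetCode

end Converse

/-! ### Asymptotic converse -/

section ConverseLimit

lemma numMessages_pos (n : ℕ) (R : ℝ≥0) : (0 : ℝ) < numMessages n R :=
  Nat.cast_pos.2 (NeZero.pos _)

lemma numMessages_le (n : ℕ) (R : ℝ≥0) : (numMessages n R : ℝ) ≤ Real.exp (n * R) :=
  Nat.floor_le (Real.exp_pos _).le

lemma exp_le_two_mul_numMessages (n : ℕ) (R : ℝ≥0) :
    Real.exp (n * R) ≤ 2 * numMessages n R := by
  have h1 : (1 : ℝ) ≤ numMessages n R := by exact_mod_cast NeZero.one_le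
  have h2 := Nat.lt_floor_add_one (Real.exp (n * R))
  change _ < (numMessages n R : ℝ) + 1 at h2
  linarith

lemma log_numMessages_le (n : ℕ) (R : ℝ≥0) : Real.log (numMessages n R) ≤ n * R :=
  (Real.log_le_iff_le_exp (numMessages_pos n R)).2 (numMessages_le n R)

lemma le_log_numMessages (n : ℕ) (R : ℝ≥0) :
    n * R - Real.log 2 ≤ Real.log (numMessages n R) := by
  have := (Real.le_log_iff_exp_le (by have := numMessages_pos n R; positivity)).2
    (exp_le_two_mul_numMessages n R)
  rw [Real.log_mul (by norm_num) (numMessages_pos n R).ne'] at this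
  linarith

variable {X Y Z : Type*} [Fintype X] [Fintype Y] [Fintype Z]

lemma exists_log_ratio_le (K : X → PMF Z) (Q : PMF Z) :
    ∃ c : ℝ, 0 ≤ c ∧ ∀ x z, Real.log (pr (K x) z / pr Q z) ≤ c := by
  obtain ⟨c, hc⟩ := (Set.finite_range fun p : X × Z =>
    Real.log (pr (K p.1) p.2 / pr Q p.2)).bddAbove
  exact ⟨max c 0, le_max_right _ _, fun x z =>
    (hc (Set.mem_range_self (x, z))).trans (le_max_left _ _)⟩

/-- The finite-blocklength bounds all concern the same letter frequencies. Their errors vanish after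
division by `n`, so a limit point of these frequencies witnesses membership. -/
theorem mem_singleLetterRegion_of_isAchievable {W : X → PMF (Y × Z)} {Q : PMF Z} {s : ℝ}
    (hs : -1 < s) {R : ℝ≥0 × ℝ≥0} (h : IsAchievable W Q s R) : R ∈ singleLetterRegion W Q s := by
  obtain ⟨C, herr, hleak⟩ := h
  have herr' : Tendsto (fun n => ((C n).errorProb W).toReal) atTop (𝓝 0) :=
    (ENNReal.tendsto_toReal ENNReal.zero_ne_top).comp herr
  have hleak' : Tendsto (fun n => ((C n).leakage W Q s).toReal) atTop (𝓝 0) :=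
    (EReal.tendsto_toReal (a := 0) (by simp) (by simp)).comp hleak
  set r := fun n => ((C n).leakage W Q s).toReal with hr
  set e := fun n => ((C n).errorProb W).toReal with he
  set H := fun n => hellinger ((C n).secretTapLaw W) ((C n).idealLaw W Q) with hH
  have hr' : ∀ᶠ n in atTop,
      renyiDiv s ((C n).secretTapLaw W) ((C n).idealLaw W Q) ≤ (r n : EReal) := by
    filter_upwards [hleak.eventually_lt_const (show (0 : EReal) < ⊤ by simp)] with n hn
    exact EReal.le_coe_toReal hn.ne
  have hn0 : ∀ᶠ n : ℕ in atTop, n ≠ 0 := eventually_ne_atTop 0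
  have hH0 : Tendsto H atTop (𝓝 0) := by
    have hup : Tendsto (fun n => if s < 0 then -s / min (-s) (1 + s) * r n else r n) atTop
        (𝓝 0) := by
      split_ifs
      · simpa using hleak'.const_mul (-s / min (-s) (1 + s))
      · exact hleak'
    refine squeeze_zero' (.of_forall fun n => hellinger_nonneg _ _) ?_ hup
    filter_upwards [hr'] with n hn
    exact hellinger_le_of_renyiDiv_le hs hn
  have hinv : ∀ c : ℝ, Tendsto (fun n : ℕ => c / n) atTop (𝓝 0) := fun c =>
    tendsto_const_div_atTop_nhds_zero_nat c
  obtain ⟨c, hc0, hc⟩ := exists_log_ratio_le (tapChannel W) Q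
  -- In `a`, the term `2 * log 2` pays for rounding down both message numbers, and the separate `log
  -- 2` comes from Fano. In `b`, the case `s ≤ 0` pays for the factor `4` and the exceptional event.
  refine mem_singleLetterRegion_of_tendsto (v := fun n => (C n).letterFreq)
    (a := fun n => (1 - e n) * ((R.1 : ℝ) + R.2 - 2 * Real.log 2 / n) - Real.log 2 / n)
    (b := fun n => if 0 < s then (R.1 : ℝ) + r n / n else
      (R.1 : ℝ) + Real.log 4 / n + c * (4 * H n))
    (e := fun n => 2 * √(H n)) ?_ ?_ ?_ ?_ ?_ ?_ ?_
  · filter_upwards [hn0] with n hn using (C n).letterFreq_mem_stdSimplex hn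
  · have h1 := ((tendsto_const_nhds (x := (1 : ℝ))).sub herr').mul
      ((tendsto_const_nhds (x := (R.1 : ℝ) + R.2)).sub (hinv (2 * Real.log 2)))
    simpa using h1.sub (hinv (Real.log 2))
  · split_ifs
    · have h1 : Tendsto (fun n => r n / n) atTop (𝓝 0) := by
        have := hleak'.mul (hinv 1)
        simpa [div_eq_mul_inv] using this
      simpa using h1.const_add (R.1 : ℝ)
    · have h1 := ((hinv (Real.log 4)).const_add (R.1 : ℝ)).add ((hH0.const_mul 4).const_mul c)
      simpa using h1
  · have := (Real.continuous_sqrt.tendsto 0).comp hH0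
    simpa using this.const_mul 2
  · filter_upwards [hn0, herr'.eventually_le_const zero_lt_one] with n hn he1
    have hn' : (0 : ℝ) < n := by positivity
    have hF := (C n).one_sub_error_mul_log_le W hn
    have heq : e n = ((numMessages n R.1 : ℝ) * numMessages n R.2)⁻¹ * ∑ m, ∑ y : Fin n → Y,
        (∏ i, pr (legitChannel W ((C n).encode m i)) (y i)) * (1 - pr ((C n).decode y) m) := by
      simp only [he]
      rw [DetCode.errorProb_eq, ENNReal.toReal_ofReal]
      exact mul_nonneg (by positivity) (Finset.sum_nonneg fun m _ => Finset.sum_nonneg fun y _ =>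
        mul_nonneg (Finset.prod_nonneg fun i _ => pr_nonneg _ _)
          (sub_nonneg.2 (pr_le_one _ _)))
    rw [← heq, Real.log_mul (numMessages_pos n R.1).ne' (numMessages_pos n R.2).ne'] at hF
    have h1 := le_log_numMessages n R.1
    have h2 := le_log_numMessages n R.2
    have h3 := mul_le_mul_of_nonneg_left (add_le_add h1 h2) (sub_nonneg.2 he1)
    have h4 : n * ((1 - e n) * ((R.1 : ℝ) + R.2 - 2 * Real.log 2 / n) - Real.log 2 / n) =
        (1 - e n) * ((n * (R.1 : ℝ) - Real.log 2) + (n * (R.2 : ℝ) - Real.log 2)) -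
          Real.log 2 := by
      field_simp
      ring
    refine le_of_mul_le_mul_left ?_ hn'
    rw [h4]
    linarith
  · filter_upwards [hn0, hr'] with n hn hrn
    have hn' : (0 : ℝ) < n := by positivity
    have h1 := log_numMessages_le n R.1
    refine le_of_mul_le_mul_left ?_ hn'
    split_ifs with hs0
    · have h2 := (C n).mul_rateReal_le_of_pos W Q hn hs0 hrn
      have : n * ((R.1 : ℝ) + r n / n) = n * R.1 + r n := by field_simp
      linarith
    · have h2 := (C n).mul_rateReal_le_of_nonpos W Q hn (not_lt.1 hs0) hc hc0
      have : n * ((R.1 : ℝ) + Real.log 4 / n + c * (4 * H n)) =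
          n * R.1 + Real.log 4 + c * n * (4 * H n) := by
        field_simp
      linarith
  · intro z
    filter_upwards [hn0] with n hn using (C n).abs_outWeight_letterFreq_sub_le W Q hn z

theorem admissibleRegion_subset {W : X → PMF (Y × Z)} {Q : PMF Z} {s : ℝ} (hs : -1 < s) :
    admissibleRegion W Q s ⊆ singleLetterRegion W Q s :=
  closure_minimal (fun _ h => mem_singleLetterRegion_of_isAchievable hs h)
    (isClosed_singleLetterRegion W Q s)

end ConverseLimit

/-! ### Exponential bounds -/

section Chernoff

variable {α : Type*} [Fintype α]

lemma sum_mul_exp_le {w f : α → ℝ} (hw0 : ∀ a, 0 ≤ w a) (hw : ∑ a, w a = 1) {c θ : ℝ}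
    (hf : ∀ a, |f a| ≤ c) (hθ : 0 ≤ θ) (hθc : θ * c ≤ 1) :
    ∑ a, w a * Real.exp (θ * f a) ≤ 1 + θ * ∑ a, w a * f a + θ ^ 2 * c ^ 2 := by
  have key : ∀ a, w a * Real.exp (θ * f a) ≤ w a + θ * (w a * f a) + w a * (θ ^ 2 * c ^ 2) := by
    intro a
    have h1 : |θ * f a| ≤ 1 := by
      rw [abs_mul, abs_of_nonneg hθ]
      exact (mul_le_mul_of_nonneg_left (hf a) hθ).trans hθc
    have h2 := (abs_le.1 (Real.abs_exp_sub_one_sub_id_le h1)).2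
    have h3 : (θ * f a) ^ 2 ≤ θ ^ 2 * c ^ 2 := by
      rw [mul_pow]
      exact mul_le_mul_of_nonneg_left (sq_le_sq' (abs_le.1 (hf a)).1 (abs_le.1 (hf a)).2)
        (sq_nonneg θ)
    have h4 := mul_le_mul_of_nonneg_left (show Real.exp (θ * f a) ≤ 1 + θ * f a + θ ^ 2 * c ^ 2 by
      linarith) (hw0 a)
    linarith
  refine (Finset.sum_le_sum fun a _ => key a).trans_eq ?_
  rw [Finset.sum_add_distrib, Finset.sum_add_distrib, ← Finset.mul_sum, ← Finset.sum_mul, hw,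
    one_mul]

/-- Chernoff's bound: sums of independent letters exceed their mean linearly with exponentially
small probability. -/
lemma exists_chernoff {w f : α → ℝ} (hw0 : ∀ a, 0 ≤ w a) (hw : ∑ a, w a = 1) {b : ℝ}
    (hb : ∑ a, w a * f a < b) :
    ∃ η : ℝ, 0 < η ∧ ∀ n : ℕ, ∑ x : Fin n → α,
      (∏ i, w (x i)) * (if n * b ≤ ∑ i, f (x i) then 1 else 0) ≤ Real.exp (-(n * η)) := by
  obtain ⟨c', hc'⟩ := (Set.finite_range fun a => |f a - b|).bddAbove
  set c := max c' 1
  have hc1 : 1 ≤ c := le_max_right _ _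
  have hc : ∀ a, |f a - b| ≤ c := fun a => (hc' (Set.mem_range_self a)).trans (le_max_left _ _)
  set E := ∑ a, w a * f a with hE
  have hEb : ∑ a, w a * (f a - b) = E - b := by
    simp_rw [mul_sub, Finset.sum_sub_distrib, ← Finset.sum_mul, hw, one_mul]
    rfl
  have hbE : b - E ≤ c := by
    have : ∑ a, w a * (-c) ≤ ∑ a, w a * (f a - b) := Finset.sum_le_sum fun a _ =>
      mul_le_mul_of_nonneg_left (abs_le.1 (hc a)).1 (hw0 a)
    rw [← Finset.sum_mul, hw, hEb] at this
    linarith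
  -- The minimizer of the quadratic bound `1 - θ (b - E) + θ ^ 2 * c ^ 2`; the estimate `b - E ≤ c`
  -- keeps `θ * c` within the range of that bound.
  set θ := (b - E) / (2 * c ^ 2) with hθ
  have hcpos : 0 < c := by linarith
  have hθ0 : 0 < θ := div_pos (by linarith) (by positivity)
  have hθc : θ * c ≤ 1 := by
    rw [hθ, div_mul_eq_mul_div, div_le_one (by positivity)]
    nlinarith
  have hM := sum_mul_exp_le hw0 hw hc hθ0.le hθc
  rw [hEb] at hM
  set M := ∑ a, w a * Real.exp (θ * (f a - b)) with hMdef
  have hM1 : M < 1 := by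
    have : θ ^ 2 * c ^ 2 = θ * (b - E) / 2 := by
      rw [hθ]; field_simp
    have := mul_pos hθ0 (show 0 < b - E by linarith)
    nlinarith
  have hM0 : 0 < M := by
    by_contra hcon
    have h0 : ∀ a, 0 ≤ w a * Real.exp (θ * (f a - b)) := fun a =>
      mul_nonneg (hw0 a) (Real.exp_pos _).le
    have h1 := (Finset.sum_eq_zero_iff_of_nonneg fun a _ => h0 a).1
      (le_antisymm (not_lt.1 hcon) (Finset.sum_nonneg fun a _ => h0 a))
    have h2 : ∑ a, w a = 0 := Finset.sum_eq_zero fun a ha =>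
      (mul_eq_zero.1 (h1 a ha)).resolve_right (Real.exp_pos _).ne'
    linarith
  refine ⟨-Real.log M, by linarith [Real.log_neg hM0 hM1], fun n => ?_⟩
  have e : Real.exp (-(n * -Real.log M)) = ∏ _i : Fin n, M := by
    rw [mul_neg, neg_neg, ← Real.log_pow, Real.exp_log (by positivity)]
    simp
  rw [e, hMdef, ← sum_pi_prod fun _ a => w a * Real.exp (θ * (f a - b))]
  refine Finset.sum_le_sum fun x _ => ?_
  rw [Finset.prod_mul_distrib, ← Real.exp_sum, ← Finset.mul_sum]
  refine mul_le_mul_of_nonneg_left ?_ (Finset.prod_nonneg fun i _ => hw0 _)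
  split_ifs with h
  · refine Real.one_le_exp (mul_nonneg hθ0.le ?_)
    rw [Finset.sum_sub_distrib]
    simp
    linarith
  · exact (Real.exp_pos _).le

lemma sum_sum_eq_sum_pair {ι β : Type*} [Fintype ι] [DecidableEq ι] [Fintype β]
    (F : (ι → α) → (ι → β) → ℝ) :
    ∑ x, ∑ y, F x y = ∑ u : ι → α × β, F (fun i => (u i).1) fun i => (u i).2 := by
  rw [← Fintype.sum_prod_type']
  exact (Fintype.sum_equiv (Equiv.arrowProdEquivProdArrow ι (fun _ => α) fun _ => β) _ _
    fun u => rfl).symm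

/-- The power sum is the moment generating function at `s` of the log-likelihood ratio under `P`, so
its second-order expansion applies. -/
lemma log_powerSum_le {P Q : PMF α} (h : AbsCont P Q) {c s : ℝ}
    (hcb : ∀ a, |Real.log (pr P a / pr Q a)| ≤ c) (hs : 0 < s) (hsc : s * c ≤ 1) :
    divReal s P Q ≤ klReal P Q + s * c ^ 2 := by
  have e : powerSum s P Q = ∑ a, pr P a * Real.exp (s * Real.log (pr P a / pr Q a)) := by
    refine Finset.sum_congr rfl fun a _ => ?_
    rcases (pr_nonneg P a).eq_or_lt with h0 | h0
    · rw [← h0, Real.zero_rpow (by linarith), zero_mul, zero_mul]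
    have hq : 0 < pr Q a := lt_of_le_of_ne (pr_nonneg _ _) fun h' => h0.ne' (h a h'.symm)
    rw [Real.rpow_add h0, Real.rpow_one, mul_assoc, Real.rpow_neg hq.le, mul_comm s,
      Real.exp_mul, Real.exp_log (by positivity), Real.div_rpow h0.le hq.le, div_eq_mul_inv]
  have h1 := sum_mul_exp_le (pr_nonneg P) (sum_pr P) hcb hs.le hsc
  have h2 := Real.log_le_sub_one_of_pos (powerSum_pos s h)
  rw [← e] at h1
  rw [divReal, if_pos hs, one_div, inv_mul_le_iff₀ hs]
  change powerSum s P Q ≤ 1 + s * klReal P Q + _ at h1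
  nlinarith

/-- The resolvability rates of orders slightly above one approach the one of order one. -/
lemma exists_rateReal_lt {X : Type*} [Fintype X] {K : X → PMF α} {Q : PMF α} {v : X → ℝ}
    (hv : v ∈ stdSimplex ℝ X) (hQ : ∀ z, outWeight K v z = pr Q z) {b : ℝ}
    (hb : rateReal 0 K Q v < b) : ∃ s : ℝ, 0 < s ∧ s ≤ 1 ∧ rateReal s K Q v < b := by
  obtain ⟨c', hc'⟩ := (Set.finite_range fun p : X × α =>
    |Real.log (pr (K p.1) p.2 / pr Q p.2)|).bddAbove
  set c := max c' 1
  have hc1 : 1 ≤ c := le_max_right _ _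
  have hc : ∀ x a, |Real.log (pr (K x) a / pr Q a)| ≤ c := fun x a =>
    (hc' (Set.mem_range_self (x, a))).trans (le_max_left _ _)
  have hcpos : 0 < c := by linarith
  set δ := b - rateReal 0 K Q v
  have hδ : 0 < δ := by simp only [δ]; linarith
  -- The first bound gives the validity of the second-order expansion; the second keeps its error
  -- term below `δ / 2`.
  set s := min (1 / c) (δ / (2 * c ^ 2)) with hs
  have hs0 : 0 < s := by positivity
  have hsc : s * c ≤ 1 := by
    have := mul_le_mul_of_nonneg_right (min_le_left (1 / c) (δ / (2 * c ^ 2))) hcpos.le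
    rwa [one_div, inv_mul_cancel₀ hcpos.ne', ← one_div] at this
  have hs1 : s ≤ 1 := by nlinarith
  have hsc2 : s * c ^ 2 ≤ δ / 2 := by
    calc s * c ^ 2 ≤ δ / (2 * c ^ 2) * c ^ 2 := by gcongr; exact min_le_right _ _
      _ = δ / 2 := by field_simp
  refine ⟨s, hs0, hs1, ?_⟩
  have : rateReal s K Q v ≤ ∑ x, (v x * divReal 0 (K x) Q + v x * (δ / 2)) := by
    refine Finset.sum_le_sum fun x _ => ?_
    rcases (hv.1 x).eq_or_lt with h0 | h0
    · simp [← h0]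
    rw [← mul_add]
    refine mul_le_mul_of_nonneg_left ?_ h0.le
    have := log_powerSum_le (absCont_of_outWeight hv hQ h0) (hc x) hs0 hsc
    rw [show divReal 0 (K x) Q = klReal (K x) Q by simp [divReal]]
    linarith
  rw [Finset.sum_add_distrib, ← Finset.sum_mul, hv.2, one_mul] at this
  change _ ≤ rateReal 0 K Q v + δ / 2 at this
  have e : rateReal 0 K Q v = b - δ := by simp only [δ]; ring
  linarith

end Chernoff

/-! ### Random codebooks -/

section Codebooks

variable {ι α β : Type*} [Fintype ι] [DecidableEq ι] [Fintype α]

/-- Averaging over random codebooks with independent codewords of law `μ`. -/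
lemma exists_codebook {μ : α → ℝ} (hμ0 : ∀ a, 0 ≤ μ a) (hμ : ∑ a, μ a = 1) (f : α → ℝ)
    (g : ι → ι → α → α → ℝ) :
    ∃ c : ι → α, (∀ m, 0 < μ (c m)) ∧
      ∑ m, (f (c m) + ∑ m' ∈ Finset.univ.erase m, g m m' (c m) (c m')) ≤
      ∑ m : ι, (∑ a, μ a * f a + ∑ m' ∈ Finset.univ.erase m, ∑ a, ∑ b, μ a * μ b * g m m' a b) := by
  set F : (ι → α) → ℝ := fun c =>
    ∑ m, (f (c m) + ∑ m' ∈ Finset.univ.erase m, g m m' (c m) (c m'))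
  set E := ∑ m : ι, (∑ a, μ a * f a +
    ∑ m' ∈ Finset.univ.erase m, ∑ a, ∑ b, μ a * μ b * g m m' a b) with hEdef
  have hE : ∑ c : ι → α, (∏ m, μ (c m)) * F c = E := by
    simp only [F]
    simp_rw [Finset.mul_sum]
    rw [Finset.sum_comm]
    refine Finset.sum_congr rfl fun m _ => ?_
    simp_rw [mul_add, Finset.sum_add_distrib, Finset.mul_sum]
    rw [sum_pi_prod_mul (w := fun _ => μ) (fun _ => hμ) m f, Finset.sum_comm]
    congr 1
    refine Finset.sum_congr rfl fun m' hm' => ?_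
    exact sum_pi_prod_mul_pair (w := fun _ => μ) (fun _ => hμ) (Finset.ne_of_mem_erase hm').symm
      (g m m')
  have hone : ∑ c : ι → α, ∏ m, μ (c m) = 1 := by
    rw [sum_pi_prod fun _ => μ]
    simp [hμ]
  -- Only codebooks whose codewords all have positive weight are compared with the mean, so the
  -- codebook found lies in the support of `μ`, where the letter constraints hold.
  by_contra! hcon
  have hprod : ∀ c : ι → α, 0 ≤ ∏ m, μ (c m) := fun c => Finset.prod_nonneg fun m _ => hμ0 _
  have hpos : ∀ c : ι → α, 0 < ∏ m, μ (c m) → E < F c := fun c hc => hcon c fun m =>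
    lt_of_le_of_ne (hμ0 _) (Ne.symm (Finset.prod_ne_zero_iff.1 hc.ne' m (Finset.mem_univ m)))
  obtain ⟨c₀, hc₀⟩ : ∃ c : ι → α, 0 < ∏ m, μ (c m) := by
    by_contra! h
    have := Finset.sum_nonpos fun c (_ : c ∈ Finset.univ) => h c
    linarith
  have hlt : ∑ c : ι → α, (∏ m, μ (c m)) * E < ∑ c : ι → α, (∏ m, μ (c m)) * F c := by
    refine Finset.sum_lt_sum (fun c _ => ?_) ⟨c₀, Finset.mem_univ _, ?_⟩
    · rcases (hprod c).eq_or_lt with h0 | h0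
      · simp [← h0]
      · exact mul_le_mul_of_nonneg_left (hpos c h0).le h0.le
    · exact mul_lt_mul_of_pos_left (hpos c₀ hc₀) hc₀
  rw [hE, ← Finset.sum_mul, hone, one_mul] at hlt
  exact lt_irrefl _ hlt

/-- A decoder that picks a message whose codeword passes a test against the output. -/
lemma exists_testDecoder [Nonempty ι] (c : ι → α) (T : α → β → Prop)
    [∀ a b, Decidable (T a b)] : ∃ d : β → ι, ∀ m y,
      (if d y = m then (0 : ℝ) else 1) ≤ (if T (c m) y then 0 else 1) +
        ∑ m' ∈ Finset.univ.erase m, if T (c m') y then 1 else 0 := by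
  classical
  have h : ∀ y, ∃ m, (∃ m', T (c m') y) → T (c m) y := by
    intro y
    by_cases hy : ∃ m', T (c m') y
    · exact ⟨hy.choose, fun _ => hy.choose_spec⟩
    · exact ⟨Classical.arbitrary ι, fun h => absurd h hy⟩
  choose d hd using h
  refine ⟨d, fun m y => ?_⟩
  have nn : ∀ m', (0 : ℝ) ≤ if T (c m') y then 1 else 0 := fun m' => by split_ifs <;> norm_num
  have nn' := Finset.sum_nonneg fun m' (_ : m' ∈ Finset.univ.erase m) => nn m'
  split_ifs with h1 h2 h2
  · simp
  · linarith
  · have := Finset.single_le_sum (fun m' _ => nn m')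
      (Finset.mem_erase.2 ⟨h1, Finset.mem_univ (d y)⟩)
    rw [if_pos (hd y ⟨m, h2⟩)] at this
    linarith
  · linarith

/-- The resolvability estimate: only single letters and pairs contribute. -/
lemma sum_rpow_mul_le {a : ι → ℝ} (ha : ∀ i, 0 ≤ a i) {q s : ℝ} (hq : 0 < q)
    (hs : 0 ≤ s) (hs1 : s ≤ 1) :
    (∑ i, a i) ^ (1 + s) * q ^ (-s) ≤ ∑ i, a i ^ (1 + s) * q ^ (-s) + (1 - s) * ∑ i, a i +
      s * ∑ i, ∑ j ∈ Finset.univ.erase i, a i * a j / q := by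
  have e : ∀ x : ℝ, 0 ≤ x → x ^ (1 + s) = x * x ^ s := fun x hx => by
    rw [Real.rpow_add_of_nonneg hx zero_le_one hs, Real.rpow_one]
  rw [e _ (Finset.sum_nonneg fun i _ => ha i), Finset.sum_mul, Finset.sum_mul, Finset.mul_sum,
    Finset.mul_sum, ← Finset.sum_add_distrib, ← Finset.sum_add_distrib]
  refine Finset.sum_le_sum fun i _ => ?_
  set b := ∑ j ∈ Finset.univ.erase i, a j with hb
  have hb0 : 0 ≤ b := Finset.sum_nonneg fun j _ => ha j
  rw [← Finset.add_sum_erase _ _ (Finset.mem_univ i), ← hb, e _ (ha i)]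
  -- Subadditivity of `x ^ s`, valid as `0 ≤ s ≤ 1`, separates the codeword itself from the others;
  -- Bernoulli's inequality then replaces the power of the others by its tangent at `b = q`, leaving
  -- only pairs.
  have h1 := Real.rpow_add_le_add_rpow (ha i) hb0 hs hs1
  have h2 : b ^ s * q ^ (-s) ≤ 1 - s + s * (b / q) := by
    rw [Real.rpow_neg hq.le, ← div_eq_mul_inv, ← Real.div_rpow hb0 hq.le]
    have := rpow_one_add_le_one_add_mul_self (s := b / q - 1)
      (by linarith [div_nonneg hb0 hq.le]) hs hs1
    rw [add_sub_cancel] at this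
    linarith
  have h3 : ∑ j ∈ Finset.univ.erase i, a i * a j / q = a i * (b / q) := by
    rw [hb, Finset.sum_div, Finset.mul_sum]
    exact Finset.sum_congr rfl fun j _ => by ring
  rw [h3]
  have h4 := mul_le_mul_of_nonneg_right h1 (Real.rpow_pos_of_pos hq (-s)).le
  have h5 := mul_le_mul_of_nonneg_left h4 (ha i)
  have h6 := mul_le_mul_of_nonneg_left h2 (ha i)
  nlinarith

end Codebooks

/-! ### Achievability by random coding -/

section OneShot

variable {α β : Type*} [Fintype α] [Fintype β]

/-- An independent codeword passes a likelihood ratio test of level `G` with probability at most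
`1 / G`. -/
lemma sum_test_le {V : α → ℝ} {k : α → β → ℝ} {o : β → ℝ} (hV0 : ∀ a, 0 ≤ V a)
    (hV : ∑ a, V a = 1) (hk : ∀ a, ∑ y, k a y = 1) (hk0 : ∀ a y, 0 ≤ k a y)
    (ho : ∀ y, ∑ a, V a * k a y = o y) {G : ℝ} (hG : 0 < G) (T : α → β → Prop)
    [∀ a y, Decidable (T a y)] (hT : ∀ a y, T a y → G * o y ≤ k a y) :
    ∑ a, ∑ b, V a * V b * ∑ y, k a y * (if T b y then 1 else 0) ≤ G⁻¹ := by
  calc _ = ∑ b, V b * ∑ y, o y * (if T b y then 1 else 0) := by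
        rw [Finset.sum_comm]
        refine Finset.sum_congr rfl fun b _ => ?_
        simp_rw [Finset.mul_sum]
        rw [Finset.sum_comm]
        refine Finset.sum_congr rfl fun y _ => ?_
        rw [← ho y, Finset.sum_mul, Finset.mul_sum]
        exact Finset.sum_congr rfl fun a _ => by ring
    _ ≤ ∑ b, V b * ∑ y, G⁻¹ * k b y := by
        refine Finset.sum_le_sum fun b _ => mul_le_mul_of_nonneg_left ?_ (hV0 b)
        refine Finset.sum_le_sum fun y _ => ?_
        split_ifs with h
        · rw [mul_one, ← div_eq_inv_mul, le_div_iff₀ hG, mul_comm]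
          exact hT b y h
        · rw [mul_zero]
          exact mul_nonneg (inv_nonneg.2 hG.le) (hk0 b y)
    _ = G⁻¹ := by
        simp_rw [← Finset.mul_sum, hk, ← Finset.sum_mul, hV]
        ring

/-- The average over two independent codewords of their normalized correlation. -/
lemma sum_correlation_le {V : α → ℝ} {w : α → β → ℝ} {q : β → ℝ}
    (ho : ∀ z, ∑ a, V a * w a z = q z) (hq : ∑ z, q z = 1) :
    ∑ a, ∑ b, V a * V b * ∑ z, w a z * w b z / q z ≤ 1 := by
  calc _ = ∑ z, q z * q z / q z := by
        simp_rw [Finset.mul_sum]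
        rw [Finset.sum_congr rfl fun a _ => Finset.sum_comm, Finset.sum_comm]
        refine Finset.sum_congr rfl fun z _ => ?_
        rw [← ho z, Finset.sum_mul_sum, Finset.sum_div]
        refine Finset.sum_congr rfl fun a _ => ?_
        rw [Finset.sum_div]
        exact Finset.sum_congr rfl fun b _ => by ring
    _ = 1 := by simp_rw [mul_self_div_self, hq]
    _ ≤ 1 := le_rfl

/-- Change of measure: nonnegative pair averages under the conditioned codeword law cost at most the
factor `t ^ 2` against the product law, where they can be computed. -/
lemma sum_sum_mul_mul_le {μ V : α → ℝ} {t : ℝ} (hμ0 : ∀ a, 0 ≤ μ a)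
    (hμV : ∀ a, μ a ≤ t * V a) {g : α → α → ℝ} (hg : ∀ a b, 0 ≤ g a b) :
    ∑ a, ∑ b, μ a * μ b * g a b ≤ t ^ 2 * ∑ a, ∑ b, V a * V b * g a b := by
  simp_rw [Finset.mul_sum]
  refine Finset.sum_le_sum fun a _ => Finset.sum_le_sum fun b _ => ?_
  calc μ a * μ b * g a b ≤ t * V a * (t * V b) * g a b :=
        mul_le_mul_of_nonneg_right (mul_le_mul (hμV a) (hμV b) (hμ0 b)
          ((hμ0 a).trans (hμV a))) (hg a b)
    _ = _ := by ring

end OneShot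

/-! ### Random coding at a fixed blocklength -/

section Achievability

namespace DetCode

variable {X Y Z : Type*} [Fintype X] [Fintype Y] [Fintype Z] {n k₀ k₁ : ℕ} [NeZero k₀] [NeZero k₁]
  (C : DetCode X Y n k₀ k₁) (W : X → PMF (Y × Z)) (Q : PMF Z)

lemma absCont_secretTapLaw (hac : ∀ m i, AbsCont (tapChannel W (C.encode m i)) Q) :
    AbsCont (C.secretTapLaw W) (C.idealLaw W Q) := by
  have h1 : (k₁ : ℝ) ≠ 0 := NeZero.ne _
  rintro ⟨j, z⟩ h
  rw [idealLaw, pr_secretTapLaw_prod, mul_eq_zero, Finset.prod_eq_zero_iff] at h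
  obtain ⟨i, _, hi⟩ := h.resolve_left (inv_ne_zero h1)
  rw [pr_secretTapLaw]
  refine Finset.sum_eq_zero fun l _ => ?_
  rw [Finset.prod_eq_zero (Finset.mem_univ i) (hac (l, j) i _ hi), mul_zero]

lemma sum_erase_ite_snd (g : Fin k₀ × Fin k₁ → ℝ) (l : Fin k₀) (j : Fin k₁) :
    ∑ m' ∈ Finset.univ.erase (l, j), (if m'.2 = j then g m' else 0) =
      ∑ l' ∈ Finset.univ.erase l, g (l', j) := by
  rw [← Finset.sum_filter]
  refine (Finset.sum_nbij' (fun l' => (l', j)) Prod.fst ?_ ?_ ?_ ?_ ?_).symm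
  · intro l' hl'
    simpa using hl'
  · rintro ⟨l', j'⟩ h
    simp only [Finset.mem_filter, Finset.mem_erase, Finset.mem_univ, and_true] at h
    obtain ⟨h, rfl⟩ := h
    simpa using h
  · simp
  · rintro ⟨l', j'⟩ h
    simp only [Finset.mem_filter] at h
    simp [h.2]
  · simp

/-- The normalized correlation of the channel outputs of two codewords. -/
noncomputable def correlation (K : X → PMF Z) (Q : PMF Z) (x x' : Fin n → X) : ℝ :=
  ∑ z : Fin n → Z, (∏ i, pr (K (x i)) (z i)) * (∏ i, pr (K (x' i)) (z i)) / ∏ i, pr Q (z i)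

/-- The power sum of a code in terms of single codewords and pairs of codewords. -/
lemma powerSum_secretTapLaw_le {s : ℝ} (hs : 0 < s) (hs1 : s ≤ 1)
    (hac : ∀ m i, AbsCont (tapChannel W (C.encode m i)) Q) :
    powerSum s (C.secretTapLaw W) (C.idealLaw W Q) ≤
      (k₀ : ℝ) ^ (-s) *
        (((k₀ : ℝ) * k₁)⁻¹ * ∑ m, ∏ i, powerSum s (tapChannel W (C.encode m i)) Q) + (1 - s) +
      s * (((k₀ : ℝ) * k₁)⁻¹ * ∑ m, ∑ m' ∈ Finset.univ.erase m, if m'.2 = m.2 then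
        (k₀ : ℝ)⁻¹ * correlation (tapChannel W) Q (C.encode m) (C.encode m') else 0) := by
  have h0 : 0 < (k₀ : ℝ) := Nat.cast_pos.2 (NeZero.pos _)
  have h1 : 0 < (k₁ : ℝ) := Nat.cast_pos.2 (NeZero.pos _)
  set a : Fin k₁ → (Fin n → Z) → Fin k₀ → ℝ := fun j z l =>
    ((k₀ : ℝ) * k₁)⁻¹ * ∏ i, pr (tapChannel W (C.encode (l, j) i)) (z i) with ha
  set q : (Fin n → Z) → ℝ := fun z => (k₁ : ℝ)⁻¹ * ∏ i, pr Q (z i) with hq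
  have ha0 : ∀ j z l, 0 ≤ a j z l := fun j z l => mul_nonneg (by positivity)
    (Finset.prod_nonneg fun i _ => pr_nonneg _ _)
  have hpoint : ∀ j z, (∑ l, a j z l) ^ (1 + s) * q z ^ (-s) ≤
      ∑ l, a j z l ^ (1 + s) * q z ^ (-s) + (1 - s) * ∑ l, a j z l +
        s * ∑ l, ∑ l' ∈ Finset.univ.erase l, a j z l * a j z l' / q z := by
    intro j z
    have hq0 : 0 ≤ q z := mul_nonneg (by positivity) (Finset.prod_nonneg fun i _ => pr_nonneg _ _)
    -- Where the ideal law vanishes, absolute continuity kills every codeword term and both sides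
    -- are zero.
    rcases hq0.eq_or_lt with hz | hz
    · have hz' : ∀ l, a j z l = 0 := by
        intro l
        have := (mul_eq_zero.1 hz.symm).resolve_left (inv_pos.2 h1).ne'
        obtain ⟨i, _, hi⟩ := Finset.prod_eq_zero_iff.1 this
        simp only [ha]
        rw [Finset.prod_eq_zero (Finset.mem_univ i) (hac (l, j) i _ hi), mul_zero]
      have hne : (1 + s) ≠ 0 := by linarith
      simp [hz', Real.zero_rpow hne]
    · exact sum_rpow_mul_le (ha0 j z) hz hs.le hs1
  have hP : powerSum s (C.secretTapLaw W) (C.idealLaw W Q) =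
      ∑ j, ∑ z, (∑ l, a j z l) ^ (1 + s) * q z ^ (-s) := by
    rw [powerSum, Fintype.sum_prod_type]
    simp_rw [idealLaw, pr_secretTapLaw_prod, pr_secretTapLaw]
    rfl
  have hmass : ∑ j, ∑ z, ∑ l, a j z l = 1 := by
    rw [← sum_pr (C.secretTapLaw W), Fintype.sum_prod_type]
    simp_rw [pr_secretTapLaw]
    rfl
  have hpairs : ∑ j, ∑ z, ∑ l, ∑ l' ∈ Finset.univ.erase l, a j z l * a j z l' / q z =
      ((k₀ : ℝ) * k₁)⁻¹ * ∑ m, ∑ m' ∈ Finset.univ.erase m, if m'.2 = m.2 then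
        (k₀ : ℝ)⁻¹ * correlation (tapChannel W) Q (C.encode m) (C.encode m') else 0 := by
    rw [Fintype.sum_prod_type, Finset.sum_comm (f := fun (l : Fin k₀) _ => _), Finset.mul_sum]
    refine Finset.sum_congr rfl fun j _ => ?_
    rw [Finset.sum_comm, Finset.mul_sum]
    refine Finset.sum_congr rfl fun l _ => ?_
    rw [sum_erase_ite_snd (fun m' => (k₀ : ℝ)⁻¹ *
      correlation (tapChannel W) Q (C.encode (l, j)) (C.encode m')) l j, Finset.sum_comm,
      Finset.mul_sum]
    refine Finset.sum_congr rfl fun l' _ => ?_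
    rw [correlation, Finset.mul_sum, Finset.mul_sum]
    refine Finset.sum_congr rfl fun z _ => ?_
    simp only [ha, hq]
    field_simp
  rw [hP]
  refine (Finset.sum_le_sum fun j _ => Finset.sum_le_sum fun z _ => hpoint j z).trans_eq ?_
  simp_rw [Finset.sum_add_distrib, ← Finset.mul_sum]
  rw [hmass, hpairs, mul_one, ← sum_rpow_codeword_eq]

end DetCode

variable {X Y Z : Type*} [Fintype X] [Fintype Y] [Fintype Z]

lemma sum_prod_mul_prod (K : X → PMF Y) (v : X → ℝ) {n : ℕ} (y : Fin n → Y) :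
    ∑ x : Fin n → X, (∏ i, v (x i)) * ∏ i, pr (K (x i)) (y i) = ∏ i, outWeight K v (y i) := by
  simp_rw [← Finset.prod_mul_distrib]
  exact sum_pi_prod fun i a => v a * pr (K a) (y i)

lemma sum_prod_pr (K : X → PMF Y) {n : ℕ} (x : Fin n → X) :
    ∑ y : Fin n → Y, ∏ i, pr (K (x i)) (y i) = 1 := by
  rw [sum_pi_prod fun i => pr (K (x i))]
  simp [sum_pr]

/-- The test fails for the true codeword only if the information density is small. -/
lemma sum_not_test_le {K : X → PMF Y} {v : X → ℝ} (hv : v ∈ stdSimplex ℝ X) (n : ℕ) (γ : ℝ)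
    [∀ (x : Fin n → X) (y : Fin n → Y), Decidable (Real.exp (n * γ) * ∏ i, outWeight K v (y i) <
      ∏ i, pr (K (x i)) (y i))] :
    ∑ x : Fin n → X, (∏ i, v (x i)) * ∑ y : Fin n → Y, (∏ i, pr (K (x i)) (y i)) *
      (if Real.exp (n * γ) * ∏ i, outWeight K v (y i) < ∏ i, pr (K (x i)) (y i) then 0 else 1) ≤
    ∑ u : Fin n → X × Y, (∏ i, v (u i).1 * pr (K (u i).1) (u i).2) *
      (if n * (-γ) ≤ ∑ i, -Real.log (pr (K (u i).1) (u i).2 / outWeight K v (u i).2)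
        then 1 else 0) := by
  simp only [Finset.mul_sum]
  rw [sum_sum_eq_sum_pair fun x y => (∏ i, v (x i)) * ((∏ i, pr (K (x i)) (y i)) *
    if Real.exp (n * γ) * ∏ i, outWeight K v (y i) < ∏ i, pr (K (x i)) (y i) then 0 else 1)]
  refine Finset.sum_le_sum fun u _ => ?_
  rw [← mul_assoc, Finset.prod_mul_distrib]
  have hVu : 0 ≤ ∏ i, v (u i).1 := Finset.prod_nonneg fun i _ => hv.1 _
  have hku : 0 ≤ ∏ i, pr (K (u i).1) (u i).2 := Finset.prod_nonneg fun i _ => pr_nonneg _ _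
  rcases (mul_nonneg hVu hku).eq_or_lt with hz | hz
  · rw [← hz, zero_mul, zero_mul]
  refine mul_le_mul_of_nonneg_left ?_ hz.le
  have hki : ∀ i, 0 < pr (K (u i).1) (u i).2 := fun i =>
    lt_of_le_of_ne (pr_nonneg _ _) (Ne.symm (Finset.prod_ne_zero_iff.1
      (right_ne_zero_of_mul hz.ne') i (Finset.mem_univ i)))
  have hvi : ∀ i, 0 < v (u i).1 := fun i =>
    lt_of_le_of_ne (hv.1 _) (Ne.symm (Finset.prod_ne_zero_iff.1
      (left_ne_zero_of_mul hz.ne') i (Finset.mem_univ i)))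
  have hoi : ∀ i, 0 < outWeight K v (u i).2 := fun i => outWeight_pos K hv (hvi i) (hki i)
  split_ifs with hT1 hT2 hT2
  · norm_num
  · exact le_rfl
  · exact le_rfl
  · refine absurd ?_ hT2
    have hk' : 0 < ∏ i, pr (K (u i).1) (u i).2 := Finset.prod_pos fun i _ => hki i
    have ho' : 0 < ∏ i, outWeight K v (u i).2 := Finset.prod_pos fun i _ => hoi i
    rw [Finset.sum_neg_distrib, ← Real.log_prod fun i _ => (div_pos (hki i) (hoi i)).ne',
      Finset.prod_div_distrib]
    have h2 := Real.log_le_log hk' (not_lt.1 hT1)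
    rw [Real.log_mul (Real.exp_pos _).ne' ho'.ne', Real.log_exp] at h2
    rw [Real.log_div hk'.ne' ho'.ne']
    linarith

lemma sum_mul_mul_correlation_le {K : X → PMF Z} {Q : PMF Z} {v : X → ℝ}
    (hQ : ∀ z, outWeight K v z = pr Q z) (n : ℕ) :
    ∑ x : Fin n → X, ∑ x', (∏ i, v (x i)) * (∏ i, v (x' i)) *
      DetCode.correlation K Q x x' ≤ 1 := by
  have ho : ∀ z : Fin n → Z, ∑ x : Fin n → X, (∏ i, v (x i)) * ∏ i, pr (K (x i)) (z i) =
      ∏ i, pr Q (z i) := fun z => by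
    rw [sum_prod_mul_prod K v z]
    exact Finset.prod_congr rfl fun i _ => hQ (z i)
  have hq : ∑ z : Fin n → Z, ∏ i, pr Q (z i) = 1 := by
    rw [sum_pi_prod fun _ => pr Q]
    simp [sum_pr]
  unfold DetCode.correlation
  exact sum_correlation_le (V := fun x : Fin n → X => ∏ i, v (x i))
    (w := fun x (z : Fin n → Z) => ∏ i, pr (K (x i)) (z i)) ho hq

/-- The random coding bound at blocklength `n`: the codewords are drawn from the product
distribution conditioned on a small sum of letter divergences, which has probability `τ`. -/
lemma exists_code {W : X → PMF (Y × Z)} {Q : PMF Z} {v : X → ℝ} (hv : v ∈ stdSimplex ℝ X)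
    (hQ : ∀ z, outWeight (tapChannel W) v z = pr Q z) {s : ℝ} (hs : 0 < s) (hs1 : s ≤ 1)
    (n k₀ k₁ : ℕ) [NeZero k₀] [NeZero k₁] {b γ τ κ : ℝ} (hτ : 0 < τ)
    (hτ' : ∑ x : Fin n → X, (∏ i, v (x i)) *
      (if n * b ≤ ∑ i, divReal s (tapChannel W (x i)) Q then 0 else 1) = τ)
    (hκ : ∑ u : Fin n → X × Y, (∏ i, v (u i).1 * pr (legitChannel W (u i).1) (u i).2) *
      (if n * (-γ) ≤ ∑ i, -Real.log (pr (legitChannel W (u i).1) (u i).2 /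
        outWeight (legitChannel W) v (u i).2) then 1 else 0) ≤ κ) :
    ∃ (C : DetCode X Y n k₀ k₁) (e : ℝ), AbsCont (C.secretTapLaw W) (C.idealLaw W Q) ∧
      C.errorProb W ≤ ENNReal.ofReal e ∧ 0 ≤ e ∧
      e + (powerSum s (C.secretTapLaw W) (C.idealLaw W Q) - 1) ≤
        τ⁻¹ * κ + τ⁻¹ ^ 2 * (k₀ * k₁ * Real.exp (-(n * γ))) + s * (τ⁻¹ ^ 2 - 1) +
          (k₀ : ℝ) ^ (-s) * Real.exp (s * (n * b)) := by
  classical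
  have h0 : 0 < (k₀ : ℝ) := Nat.cast_pos.2 (NeZero.pos _)
  have h1 : 0 < (k₁ : ℝ) := Nat.cast_pos.2 (NeZero.pos _)
  set K := legitChannel W with hK
  set N : ℝ := (k₀ : ℝ) * k₁ with hN
  have hNpos : 0 < N := by positivity
  set V : (Fin n → X) → ℝ := fun x => ∏ i, v (x i) with hVdef
  have hV0 : ∀ x, 0 ≤ V x := fun x => Finset.prod_nonneg fun i _ => hv.1 _
  have hV : ∑ x, V x = 1 := by
    simp only [hVdef]
    rw [sum_pi_prod fun _ => v]
    simp [hv.2]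
  set k : (Fin n → X) → (Fin n → Y) → ℝ := fun x y => ∏ i, pr (K (x i)) (y i) with hkdef
  have hk0 : ∀ x y, 0 ≤ k x y := fun x y => Finset.prod_nonneg fun i _ => pr_nonneg _ _
  set o : (Fin n → Y) → ℝ := fun y => ∏ i, outWeight K v (y i) with hodef
  -- The conditioned codeword law: it bounds the power sum of every selected codeword, not merely
  -- the average over the random draw.
  set μ : (Fin n → X) → ℝ := fun x => τ⁻¹ * (V x *
    if n * b ≤ ∑ i, divReal s (tapChannel W (x i)) Q then 0 else 1) with hμdef
  have hμ0 : ∀ x, 0 ≤ μ x := fun x => mul_nonneg (by positivity) (mul_nonneg (hV0 x)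
    (by split_ifs <;> norm_num))
  have hμ : ∑ x, μ x = 1 := by
    simp only [hμdef]
    rw [← Finset.mul_sum, hτ', inv_mul_cancel₀ hτ.ne']
  have hμV : ∀ x, μ x ≤ τ⁻¹ * V x := fun x => by
    refine mul_le_mul_of_nonneg_left ?_ (by positivity)
    have := hV0 x
    split_ifs <;> linarith
  set T : (Fin n → X) → (Fin n → Y) → Prop := fun x y => Real.exp (n * γ) * o y < k x y with hT
  set f : (Fin n → X) → ℝ := fun x => ∑ y, k x y * (if T x y then 0 else 1) with hf
  set β : (Fin n → X) → (Fin n → X) → ℝ := fun x x' =>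
    ∑ y, k x y * (if T x' y then 1 else 0) with hβ
  set χ : (Fin n → X) → (Fin n → X) → ℝ := fun x x' =>
    DetCode.correlation (tapChannel W) Q x x' with hχ
  have hf0 : ∀ x, 0 ≤ f x := fun x => Finset.sum_nonneg fun y _ => mul_nonneg (hk0 x y)
    (by split_ifs <;> norm_num)
  have hβ0 : ∀ x x', 0 ≤ β x x' := fun x x' => Finset.sum_nonneg fun y _ => mul_nonneg (hk0 x y)
    (by split_ifs <;> norm_num)
  have hχ0 : ∀ x x', 0 ≤ χ x x' := fun x x' => Finset.sum_nonneg fun z _ => div_nonneg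
    (mul_nonneg (Finset.prod_nonneg fun i _ => pr_nonneg _ _)
      (Finset.prod_nonneg fun i _ => pr_nonneg _ _)) (Finset.prod_nonneg fun i _ => pr_nonneg _ _)
  have hEf : ∑ x, μ x * f x ≤ τ⁻¹ * κ := by
    calc _ ≤ ∑ x, τ⁻¹ * (V x * f x) := Finset.sum_le_sum fun x _ => by
          rw [← mul_assoc]
          exact mul_le_mul_of_nonneg_right (hμV x) (hf0 x)
      _ ≤ τ⁻¹ * κ := by
          rw [← Finset.mul_sum]
          exact mul_le_mul_of_nonneg_left ((sum_not_test_le hv n γ).trans hκ) (by positivity)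
  have hEβ : ∑ x, ∑ x', μ x * μ x' * β x x' ≤ τ⁻¹ ^ 2 * Real.exp (-(n * γ)) := by
    refine (sum_sum_mul_mul_le hμ0 hμV hβ0).trans ?_
    refine mul_le_mul_of_nonneg_left ?_ (by positivity)
    rw [Real.exp_neg]
    exact sum_test_le hV0 hV (fun x => sum_prod_pr K x) hk0 (fun y => sum_prod_mul_prod K v y)
      (Real.exp_pos _) T fun x y h => le_of_lt h
  have hEχ : ∑ x, ∑ x', μ x * μ x' * χ x x' ≤ τ⁻¹ ^ 2 := by
    refine (sum_sum_mul_mul_le hμ0 hμV hχ0).trans ?_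
    exact mul_le_of_le_one_right (by positivity) (sum_mul_mul_correlation_le hQ n)
  -- Decoding errors and output correlations enter one objective, so a single codebook serves both.
  -- Correlations count only between codewords with the same secret message.
  obtain ⟨c, hcpos, hc⟩ := exists_codebook (ι := Fin k₀ × Fin k₁) hμ0 hμ f fun m m' x x' =>
    β x x' + s * if m'.2 = m.2 then (k₀ : ℝ)⁻¹ * χ x x' else 0
  obtain ⟨d, hd⟩ := exists_testDecoder c T
  have hletters : ∀ m, (∀ i, AbsCont (tapChannel W (c m i)) Q) ∧
      ∑ i, divReal s (tapChannel W (c m i)) Q ≤ n * b := by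
    intro m
    have hm := right_ne_zero_of_mul (hcpos m).ne'
    refine ⟨fun i => absCont_of_outWeight hv hQ (lt_of_le_of_ne (hv.1 _)
      (Ne.symm (Finset.prod_ne_zero_iff.1 (left_ne_zero_of_mul hm) i (Finset.mem_univ i)))), ?_⟩
    by_contra hcon
    exact right_ne_zero_of_mul hm (if_pos (not_le.1 hcon).le)
  set C : DetCode X Y n k₀ k₁ := ⟨c, fun y => PMF.pure (d y)⟩ with hC
  have hcard : ∑ _m : Fin k₀ × Fin k₁, (1 : ℝ) = N := by simp [hN]
  set e := N⁻¹ * ∑ m, (f (c m) + ∑ m' ∈ Finset.univ.erase m, β (c m) (c m')) with he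
  set x := N⁻¹ * ∑ m, ∑ m' ∈ Finset.univ.erase m,
    (if m'.2 = m.2 then (k₀ : ℝ)⁻¹ * χ (c m) (c m') else 0) with hx
  have hbound : e + s * x ≤
      τ⁻¹ * κ + τ⁻¹ ^ 2 * (N * Real.exp (-(n * γ))) + s * τ⁻¹ ^ 2 := by
    have hleft : e + s * x = N⁻¹ * ∑ m, (f (c m) + ∑ m' ∈ Finset.univ.erase m,
        (β (c m) (c m') + s * if m'.2 = m.2 then (k₀ : ℝ)⁻¹ * χ (c m) (c m') else 0)) := by
      rw [he, hx]
      simp_rw [Finset.sum_add_distrib, ← Finset.mul_sum]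
      ring
    rw [hleft, inv_mul_le_iff₀ hNpos, mul_comm N]
    refine hc.trans ?_
    rw [← hcard, Finset.mul_sum]
    refine Finset.sum_le_sum fun m _ => ?_
    rw [mul_one, add_assoc]
    refine add_le_add hEf ?_
    simp_rw [mul_add, Finset.sum_add_distrib]
    refine add_le_add ?_ ?_
    · have hβsum : 0 ≤ ∑ x, ∑ x', μ x * μ x' * β x x' := Finset.sum_nonneg fun x _ =>
        Finset.sum_nonneg fun x' _ => mul_nonneg (mul_nonneg (hμ0 x) (hμ0 x')) (hβ0 x x')
      rw [hcard, Finset.sum_const, nsmul_eq_mul]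
      have hle : ((Finset.univ.erase m).card : ℝ) ≤ N := by
        have := Finset.card_le_univ (Finset.univ.erase m)
        simp only [Fintype.card_prod, Fintype.card_fin] at this
        rw [hN]
        exact_mod_cast this
      calc _ ≤ N * (τ⁻¹ ^ 2 * Real.exp (-(n * γ))) :=
            mul_le_mul hle hEβ hβsum hNpos.le
        _ = _ := by ring
    · have hterm : ∀ m' : Fin k₀ × Fin k₁, ∑ x, ∑ x', μ x * μ x' *
          (s * if m'.2 = m.2 then (k₀ : ℝ)⁻¹ * χ x x' else 0) =
          if m'.2 = m.2 then s * ((k₀ : ℝ)⁻¹ * ∑ x, ∑ x', μ x * μ x' * χ x x') else 0 := by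
        intro m'
        split_ifs
        · simp_rw [Finset.mul_sum]
          exact Finset.sum_congr rfl fun x _ => Finset.sum_congr rfl fun x' _ => by ring
        · simp
      rw [Finset.sum_congr rfl fun m' _ => hterm m']
      obtain ⟨l, j⟩ := m
      rw [DetCode.sum_erase_ite_snd (fun _ => s * ((k₀ : ℝ)⁻¹ * ∑ x, ∑ x', μ x * μ x' * χ x x')) l j]
      have hχsum : 0 ≤ ∑ x, ∑ x', μ x * μ x' * χ x x' := Finset.sum_nonneg fun x _ =>
        Finset.sum_nonneg fun x' _ => mul_nonneg (mul_nonneg (hμ0 x) (hμ0 x')) (hχ0 x x')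
      -- At most `k₀` codewords share a secret message, which cancels the weight `k₀⁻¹`.
      calc _ ≤ ∑ _l : Fin k₀, s * ((k₀ : ℝ)⁻¹ * ∑ x, ∑ x', μ x * μ x' * χ x x') :=
            Finset.sum_le_sum_of_subset_of_nonneg (Finset.subset_univ _) fun _ _ _ => by positivity
        _ = s * ∑ x, ∑ x', μ x * μ x' * χ x x' := by
            simp
            field_simp
        _ ≤ _ := by gcongr
  refine ⟨C, e, C.absCont_secretTapLaw W Q fun m i => (hletters m).1 i, ?_, ?_, ?_⟩
  · rw [DetCode.errorProb_eq]
    refine ENNReal.ofReal_le_ofReal (mul_le_mul_of_nonneg_left ?_ (by positivity))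
    refine Finset.sum_le_sum fun m _ => ?_
    simp only [hf, hβ]
    rw [Finset.sum_comm, ← Finset.sum_add_distrib]
    refine Finset.sum_le_sum fun y _ => ?_
    rw [← Finset.mul_sum, ← mul_add]
    refine mul_le_mul_of_nonneg_left ?_ (hk0 (c m) y)
    refine le_trans (le_of_eq ?_) (hd m y)
    simp only [hC, pr, PMF.pure_apply]
    by_cases h : d y = m
    · simp [h]
    · simp [h, Ne.symm h]
  · exact mul_nonneg (by positivity) (Finset.sum_nonneg fun m _ => add_nonneg (hf0 _)
      (Finset.sum_nonneg fun m' _ => hβ0 _ _))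
  -- The mass term `1 - s` and the pair term `s * τ⁻¹ ^ 2` exceed one only by `s * (τ⁻¹ ^ 2 - 1)`.
  · have hps := C.powerSum_secretTapLaw_le W Q hs hs1 fun m i => (hletters m).1 i
    change _ ≤ _ + (1 - s) + s * x at hps
    have hlead : N⁻¹ * ∑ m, ∏ i, powerSum s (tapChannel W (C.encode m i)) Q ≤
        Real.exp (s * (n * b)) := by
      rw [inv_mul_le_iff₀ hNpos, ← hcard, Finset.sum_mul]
      refine Finset.sum_le_sum fun m _ => ?_
      rw [one_mul]
      have : ∏ i, powerSum s (tapChannel W (C.encode m i)) Q =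
          Real.exp (s * ∑ i, divReal s (tapChannel W (c m i)) Q) := by
        rw [Finset.mul_sum, Real.exp_sum]
        refine Finset.prod_congr rfl fun i _ => ?_
        rw [divReal, if_pos hs, ← mul_assoc, mul_one_div_cancel hs.ne', one_mul,
          Real.exp_log (powerSum_pos s ((hletters m).1 i))]
      rw [this]
      exact Real.exp_le_exp.2 (mul_le_mul_of_nonneg_left (hletters m).2 hs.le)
    have hlead' := mul_le_mul_of_nonneg_left hlead (Real.rpow_nonneg h0.le (-s))
    linarith

end Achievability

/-! ### Asymptotic achievability and comparison of the regions -/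

section Regions

variable {X Y Z : Type*} [Fintype X] [Fintype Y] [Fintype Z]

lemma rateReal_of_nonpos {s : ℝ} (hs : s ≤ 0) (K : X → PMF Z) (Q : PMF Z) (v : X → ℝ) :
    rateReal s K Q v = rateReal 0 K Q v := by
  simp [rateReal, divReal, not_lt.2 hs]

lemma rateReal_nonneg {s : ℝ} {K : X → PMF Z} {Q : PMF Z} {v : X → ℝ}
    (hv : v ∈ stdSimplex ℝ X) (hQ : ∀ z, outWeight K v z = pr Q z) : 0 ≤ rateReal s K Q v := by
  refine Finset.sum_nonneg fun x _ => ?_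
  rcases (hv.1 x).eq_or_lt with h0 | h0
  · simp [← h0]
  have hac := absCont_of_outWeight hv hQ h0
  refine mul_nonneg h0.le ?_
  unfold divReal
  split_ifs with hs
  · exact mul_nonneg (by positivity) (Real.log_nonneg (one_le_powerSum hs.le hac))
  · exact klReal_nonneg hac

lemma tendsto_exp_neg_mul_atTop {η : ℝ} (hη : 0 < η) :
    Tendsto (fun n : ℕ => Real.exp (-(n * η))) atTop (𝓝 0) :=
  Real.tendsto_exp_neg_atTop_nhds_zero.comp
    (tendsto_natCast_atTop_atTop.atTop_mul_const hη)

lemma numMessages_rpow_neg_le (n : ℕ) (R : ℝ≥0) {s : ℝ} (hs : 0 < s) :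
    (numMessages n R : ℝ) ^ (-s) ≤ 2 ^ s * Real.exp (-(s * (n * R))) := by
  have h1 : Real.exp (n * R) / 2 ≤ numMessages n R := by
    linarith [exp_le_two_mul_numMessages n R]
  refine (Real.rpow_le_rpow_of_nonpos (by positivity) h1 (by linarith)).trans_eq ?_
  rw [Real.div_rpow (Real.exp_pos _).le (by norm_num), ← Real.exp_mul,
    Real.rpow_neg (by norm_num : (0 : ℝ) ≤ 2), div_inv_eq_mul, mul_comm]
  congr 2
  ring

/-- Random coding achieves every pair of rates strictly inside the single-letter bounds. -/
theorem isAchievable_of_lt {W : X → PMF (Y × Z)} {Q : PMF Z} {s : ℝ} (hs : -1 < s) (hs1 : s ≤ 1)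
    {v : X → ℝ} (hv : v ∈ stdSimplex ℝ X) (hQ : ∀ z, outWeight (tapChannel W) v z = pr Q z)
    {R : ℝ≥0 × ℝ≥0} (hrate : rateReal s (tapChannel W) Q v < R.1)
    (hinfo : (R.1 : ℝ) + R.2 < infoReal (legitChannel W) v) : IsAchievable W Q s R := by
  -- For `s ≤ 0` a small positive order `s₀` is used instead: its rate is still below `R₀`, and its
  -- power sum controls the leakage of order `1 + s`.
  obtain ⟨s₀, hs₀, hs₀1, hss, hrate₀⟩ : ∃ s₀ : ℝ, 0 < s₀ ∧ s₀ ≤ 1 ∧ (s = s₀ ∨ s ≤ 0) ∧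
      rateReal s₀ (tapChannel W) Q v < R.1 := by
    rcases lt_or_ge 0 s with h | h
    · exact ⟨s, h, hs1, Or.inl rfl, hrate⟩
    · rw [rateReal_of_nonpos h] at hrate
      obtain ⟨s₀, h1, h2, h3⟩ := exists_rateReal_lt hv hQ hrate
      exact ⟨s₀, h1, h2, Or.inr h, h3⟩
  obtain ⟨b, hb, hbR⟩ := exists_between hrate₀
  obtain ⟨γ, hγR, hγ⟩ := exists_between hinfo
  set K := legitChannel W with hK
  obtain ⟨η₁, hη₁, hch₁⟩ := exists_chernoff (f := fun x => divReal s₀ (tapChannel W x) Q)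
    hv.1 hv.2 hb
  obtain ⟨η₂, hη₂, hch₂⟩ := exists_chernoff (w := fun u : X × Y => v u.1 * pr (K u.1) u.2)
    (f := fun u => -Real.log (pr (K u.1) u.2 / outWeight K v u.2)) (b := -γ)
    (fun u => mul_nonneg (hv.1 _) (pr_nonneg _ _))
    (by
      rw [Fintype.sum_prod_type]
      simp_rw [← Finset.mul_sum, sum_pr, mul_one]
      exact hv.2)
    (by
      rw [infoReal_eq K hv] at hγ
      rw [Fintype.sum_prod_type]
      simp_rw [mul_neg, Finset.sum_neg_distrib, mul_assoc, ← Finset.mul_sum]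
      linarith)
  set τ : ℕ → ℝ := fun n => ∑ x : Fin n → X, (∏ i, v (x i)) *
      (if n * b ≤ ∑ i, divReal s₀ (tapChannel W (x i)) Q then 0 else 1) with hτ
  have hτ1 : ∀ n : ℕ, 1 - Real.exp (-(n * η₁)) ≤ τ n ∧ τ n ≤ 1 := by
    intro n
    have hone : ∑ x : Fin n → X, ∏ i, v (x i) = 1 := by
      rw [sum_pi_prod fun _ => v]
      simp [hv.2]
    have hsum : τ n + ∑ x : Fin n → X, (∏ i, v (x i)) *
        (if n * b ≤ ∑ i, divReal s₀ (tapChannel W (x i)) Q then 1 else 0) = 1 := by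
      rw [hτ, ← Finset.sum_add_distrib]
      refine Eq.trans ?_ hone
      refine Finset.sum_congr rfl fun x _ => ?_
      split_ifs <;> ring
    have hnn : 0 ≤ ∑ x : Fin n → X, (∏ i, v (x i)) *
        (if n * b ≤ ∑ i, divReal s₀ (tapChannel W (x i)) Q then (1 : ℝ) else 0) :=
      Finset.sum_nonneg fun x _ => mul_nonneg (Finset.prod_nonneg fun i _ => hv.1 _)
        (by split_ifs <;> norm_num)
    exact ⟨by linarith [hch₁ n], by linarith⟩
  have hτlim : Tendsto τ atTop (𝓝 1) := by
    refine tendsto_of_tendsto_of_tendsto_of_le_of_le ?_ tendsto_const_nhds (fun n => (hτ1 n).1)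
      fun n => (hτ1 n).2
    simpa using (tendsto_exp_neg_mul_atTop hη₁).const_sub 1
  -- The four terms account for a failed test of the true codeword, a wrong codeword passing, the
  -- cost of conditioning, and the single-codeword power sums; the strict gaps `R₀ + R₁ < γ` and `b
  -- < R₀` make the exponents negative.
  set B : ℕ → ℝ := fun n => (τ n)⁻¹ * Real.exp (-(n * η₂)) +
    (τ n)⁻¹ ^ 2 * Real.exp (-(n * (γ - (R.1 + R.2)))) + s₀ * ((τ n)⁻¹ ^ 2 - 1) +
      2 ^ s₀ * Real.exp (-(n * (s₀ * (R.1 - b)))) with hB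
  have hBlim : Tendsto B atTop (𝓝 0) := by
    have hinv : Tendsto (fun n => (τ n)⁻¹) atTop (𝓝 1) := by
      simpa using hτlim.inv₀ one_ne_zero
    have h1 := hinv.mul (tendsto_exp_neg_mul_atTop hη₂)
    have h2 := (hinv.pow 2).mul (tendsto_exp_neg_mul_atTop (sub_pos.2 hγR))
    have h3 := ((hinv.pow 2).sub_const 1).const_mul s₀
    have h4 := (tendsto_exp_neg_mul_atTop (mul_pos hs₀ (sub_pos.2 hbR))).const_mul ((2 : ℝ) ^ s₀)
    have h5 := ((h1.add h2).add h3).add h4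
    rwa [show (1 : ℝ) * 0 + 1 ^ 2 * 0 + s₀ * (1 ^ 2 - 1) + 2 ^ s₀ * 0 = 0 by ring] at h5
  have hcode : ∀ n, ∃ C : DetCode X Y n (numMessages n R.1) (numMessages n R.2), 0 < τ n →
      C.errorProb W ≤ ENNReal.ofReal (B n) ∧
        C.leakage W Q s ∈ Set.Icc 0 ((B n / s₀ : ℝ) : EReal) := by
    intro n
    by_cases hn : 0 < τ n
    · obtain ⟨C, e, hac, herr, he, hbound⟩ := exists_code (W := W) hv hQ hs₀ hs₀1 n
        (numMessages n R.1) (numMessages n R.2) (γ := γ) hn rfl (hch₂ n)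
      refine ⟨C, fun _ => ?_⟩
      have hinv : 0 ≤ (τ n)⁻¹ ^ 2 := by positivity
      have hle : e + (powerSum s₀ (C.secretTapLaw W) (C.idealLaw W Q) - 1) ≤ B n := by
        refine hbound.trans (add_le_add (add_le_add (add_le_add le_rfl
          (mul_le_mul_of_nonneg_left ?_ hinv)) le_rfl) ?_)
        · calc _ ≤ Real.exp (n * R.1) * Real.exp (n * R.2) * Real.exp (-(n * γ)) := by
                gcongr
                · exact numMessages_le n R.1
                · exact numMessages_le n R.2
            _ = _ := by
                rw [← Real.exp_add, ← Real.exp_add]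
                congr 1
                ring
        · calc _ ≤ 2 ^ s₀ * Real.exp (-(s₀ * (n * R.1))) * Real.exp (s₀ * (n * b)) := by
                gcongr
                exact numMessages_rpow_neg_le n R.1 hs₀
            _ = _ := by
                rw [mul_assoc, ← Real.exp_add]
                congr 2
                ring
      have hps := one_le_powerSum hs₀.le hac
      exact ⟨herr.trans (ENNReal.ofReal_le_ofReal (by linarith)),
        renyiDiv_mem_Icc hs hs₀ hss hac (show powerSum s₀ (C.secretTapLaw W) (C.idealLaw W Q) ≤ _ by
          linarith)⟩
    -- A code must exist at every blocklength; where `τ n` is not positive an arbitrary one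
    -- suffices, since `τ n` is eventually positive.
    · have : Nonempty X := by
        by_contra hX
        rw [not_nonempty_iff] at hX
        have := hv.2
        simp at this
      obtain ⟨x₀⟩ := this
      exact ⟨⟨fun _ _ => x₀, fun _ => PMF.pure (0, 0)⟩, fun h => absurd h hn⟩
  choose C hC using hcode
  have hpos : ∀ᶠ n in atTop, 0 < τ n := hτlim.eventually_const_lt zero_lt_one
  refine ⟨C, ?_, ?_⟩
  · have h1 : Tendsto (fun n => ENNReal.ofReal (B n)) atTop (𝓝 0) := by
      simpa using ENNReal.tendsto_ofReal hBlim
    refine tendsto_of_tendsto_of_tendsto_of_le_of_le' tendsto_const_nhds h1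
      (.of_forall fun n => zero_le) ?_
    filter_upwards [hpos] with n hn using (hC n hn).1
  · have h1 : Tendsto (fun n => ((B n / s₀ : ℝ) : EReal)) atTop (𝓝 0) := by
      have := (continuous_coe_real_ereal.tendsto 0).comp
        (show Tendsto (fun n => B n / s₀) atTop (𝓝 0) by simpa using hBlim.div_const s₀)
      exact this
    refine tendsto_of_tendsto_of_tendsto_of_le_of_le' tendsto_const_nhds h1 ?_ ?_
    · filter_upwards [hpos] with n hn using (hC n hn).2.1
    · filter_upwards [hpos] with n hn using (hC n hn).2.2

/-- Pairs of the single-letter region with positive secret rate are admissible. -/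
theorem mem_admissibleRegion_of_pos {W : X → PMF (Y × Z)} {Q : PMF Z} {s : ℝ} (hs : -1 < s)
    (hs1 : s ≤ 1) {R : ℝ≥0 × ℝ≥0} (hR : R ∈ singleLetterRegion W Q s) (hpos : 0 < R.2) :
    R ∈ admissibleRegion W Q s := by
  obtain ⟨v, hv, hQ, h1, h2⟩ := mem_singleLetterRegion_iff.1 hR
  -- With `δ = R₁ / (k + 3)`, the pair `(R₀ + δ, R₁ - 2δ)` satisfies both bounds strictly, since the
  -- sum drops by `δ`. The offset `3` ensures `2δ ≤ R₁`, so the truncated subtraction is exact.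
  have hδ : Tendsto (fun k : ℕ => R.2 / ((k : ℝ≥0) + 3)) atTop (𝓝 0) := by
    rw [← NNReal.tendsto_coe]
    push_cast
    exact tendsto_const_nhds.div_atTop
      (tendsto_atTop_add_const_right _ _ tendsto_natCast_atTop_atTop)
  have hlim : Tendsto (fun k : ℕ => (R.1 + R.2 / ((k : ℝ≥0) + 3),
      R.2 - 2 * (R.2 / ((k : ℝ≥0) + 3)))) atTop (𝓝 R) := by
    have h := (hδ.const_add R.1).prodMk_nhds
      ((tendsto_const_nhds (x := R.2)).sub (hδ.const_mul 2))
    rwa [show (R.1 + 0, R.2 - 2 * 0) = R by simp] at h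
  refine mem_closure_of_tendsto hlim (.of_forall fun k => ?_)
  have hd : 0 < (R.2 : ℝ) / ((k : ℝ) + 3) := div_pos (by exact_mod_cast hpos) (by positivity)
  have hd2 : 2 * (R.2 / ((k : ℝ≥0) + 3)) ≤ R.2 := by
    rw [← NNReal.coe_le_coe]
    push_cast
    rw [← mul_div_assoc, div_le_iff₀ (by positivity)]
    have : (0 : ℝ) ≤ R.2 := R.2.2
    nlinarith [Nat.cast_nonneg (α := ℝ) k]
  refine isAchievable_of_lt hs hs1 hv hQ ?_ ?_
  · push_cast
    linarith
  · rw [NNReal.coe_sub hd2]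
    push_cast
    linarith

/-- If some input distribution leaves room for a secret rate, the whole single-letter region is
admissible. -/
theorem singleLetterRegion_subset_of_exists {W : X → PMF (Y × Z)} {Q : PMF Z} {s : ℝ}
    (hs : -1 < s) (hs1 : s ≤ 1) (h : ∃ P ∈ inducing (tapChannel W) Q,
      resolvabilityRate s P (tapChannel W) Q < mutualInfo P (legitChannel W)) :
    singleLetterRegion W Q s ⊆ admissibleRegion W Q s := by
  obtain ⟨P, hP, hlt⟩ := h
  have hQ := mem_inducing_iff.1 hP
  have hv := pr_mem_stdSimplex P
  rw [resolvabilityRate_eq hP, mutualInfo_eq, EReal.coe_lt_coe_iff] at hlt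
  set rate := rateReal s (tapChannel W) Q (pr P)
  have hrate : 0 ≤ rate := rateReal_nonneg hv hQ
  -- The corner point of the region of `P`; any positive weight on it gives a mixture a positive
  -- secret rate.
  set R' : ℝ≥0 × ℝ≥0 := (⟨rate, hrate⟩, ⟨infoReal (legitChannel W) (pr P) - rate, by linarith⟩)
  have hR' : R' ∈ singleLetterRegion W Q s := by
    refine mem_singleLetterRegion_iff.2 ⟨pr P, hv, hQ, ?_, le_rfl⟩
    change rate + (infoReal (legitChannel W) (pr P) - rate) ≤ _
    linarith
  have hpos : 0 < R'.2 := by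
    rw [← NNReal.coe_pos]
    change 0 < infoReal (legitChannel W) (pr P) - rate
    linarith
  intro R hR
  have ha : Tendsto (fun k : ℕ => ((k : ℝ≥0) + 1)⁻¹) atTop (𝓝 0) := by
    rw [← NNReal.tendsto_coe]
    push_cast
    simpa using tendsto_one_div_add_atTop_nhds_zero_nat (𝕜 := ℝ)
  have hlim : Tendsto (fun k : ℕ => (1 - ((k : ℝ≥0) + 1)⁻¹) • R + ((k : ℝ≥0) + 1)⁻¹ • R') atTop
      (𝓝 R) := by
    have := ((tendsto_const_nhds (x := (1 : ℝ≥0))).sub ha).smul_const R |>.add (ha.smul_const R')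
    simpa using this
  refine isClosed_closure.mem_of_tendsto hlim (.of_forall fun k => ?_)
  have hle : ((k : ℝ≥0) + 1)⁻¹ ≤ 1 := inv_le_one_of_one_le₀ (by simp)
  refine mem_admissibleRegion_of_pos hs hs1
    (combo_mem_singleLetterRegion hR hR' (tsub_add_cancel_of_le hle)) ?_
  refine add_pos_of_nonneg_of_pos zero_le ?_
  exact mul_pos (by positivity) hpos

/-- A pair in the region would give `R̃ ≤ R₀ ≤ R₀ + R₁ ≤ I` for some `P`. -/
lemma singleLetterRegion_eq_empty {W : X → PMF (Y × Z)} {Q : PMF Z} {s : ℝ}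
    (h : ∀ P ∈ inducing (tapChannel W) Q,
      mutualInfo P (legitChannel W) < resolvabilityRate s P (tapChannel W) Q) :
    singleLetterRegion W Q s = ∅ := by
  refine Set.eq_empty_of_forall_notMem fun R hR => ?_
  simp only [singleLetterRegion, Set.mem_iUnion, Set.mem_ofPred_eq, exists_prop] at hR
  obtain ⟨P, hP, h1, h2⟩ := hR
  have h3 : ((R.1 : ℝ) : EReal) ≤ (((R.1 : ℝ) + (R.2 : ℝ) : ℝ) : EReal) := by
    exact_mod_cast le_add_of_nonneg_right R.2.2
  exact absurd (h P hP) (not_lt.2 ((h2.trans h3).trans h1))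

end Regions

end Wiretap

theorem theorem7 {X Y Z : Type*} [Fintype X] [Fintype Y] [Fintype Z]
    (W : X → PMF (Y × Z)) (Q : PMF Z) (s : ℝ) (hs : -1 < s) (hs' : s ≤ 1) :
    -- equality, except in the degenerate case where `I(X;Y) - R̃` has maximum exactly zero
    (((∃ P ∈ Wiretap.inducing (Wiretap.tapChannel W) Q,
          Wiretap.resolvabilityRate s P (Wiretap.tapChannel W) Q <
            Wiretap.mutualInfo P (Wiretap.legitChannel W)) ∨
        (∀ P ∈ Wiretap.inducing (Wiretap.tapChannel W) Q,
          Wiretap.mutualInfo P (Wiretap.legitChannel W) <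
            Wiretap.resolvabilityRate s P (Wiretap.tapChannel W) Q)) →
      Wiretap.admissibleRegion W Q s = Wiretap.singleLetterRegion W Q s) ∧
    -- in every case: the converse, and equality at all positive rates `R₁` of the secret message
    Wiretap.admissibleRegion W Q s ⊆ Wiretap.singleLetterRegion W Q s ∧
    (∀ R : ℝ≥0 × ℝ≥0, 0 < R.2 →
      (R ∈ Wiretap.admissibleRegion W Q s ↔ R ∈ Wiretap.singleLetterRegion W Q s)) := by
  have hsub := Wiretap.admissibleRegion_subset (W := W) (Q := Q) hs
  refine ⟨?_, hsub, fun R hR =>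
    ⟨fun h => hsub h, fun h => Wiretap.mem_admissibleRegion_of_pos hs hs' h hR⟩⟩
  rintro (h | h)
  · exact hsub.antisymm (Wiretap.singleLetterRegion_subset_of_exists hs hs' h)
  · rw [Wiretap.singleLetterRegion_eq_empty h] at hsub ⊢
    exact Set.subset_empty_iff.1 hsub
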